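/- Let $G$ and $H$ be discrete groups with unit $e$, let $\mathcal A=(A_g)_{g\in G}$ and $\mathcal B=(B_h)_{h\in H}$ be Fell bundles over $G$ and $H$, and let $\varphi\colon G\to H$ be a group homomorphism. Here a Fell bundle $\mathcal A$ over $G$ is a family of complex Banach spaces $A_g$ with an associative multiplication that is bilinear as a map $A_g\times A_h\to A_{gh}$ and satisfies $\|ab\|\le\|a\|\|b\|$, and an involutive, anti-multiplicative map that is conjugate-linear and isometric from $A_g$ to $A_{g^{-1}}$, such that $\|a^*a\|=\|a\|^2$ and $a^*a\ge 0$ in the $C^*$-algebra $A_e$ for all $g\in G$, $a\in A_g$. Let $C_c(\mathcal A)$ be the $*$-algebra of finitely supported sections $f$ (with $f(g)\in A_g$), with $(f_1*f_2)(h)=\sum_{g} f_1(g)f_2(g^{-1}h)$ and $f^*(h)=f(h^{-1})^*$; let $j^{\mathcal A}_g\colon A_g\to C_c(\mathcal A)$ be the canonical injection, let $\|f\|_{\rm u}$ be the supremum of $p(f)$ over all $C^*$-seminorms $p$ on $C_c(\mathcal A)$, let $C^*(\mathcal A)$ be the completion of $C_c(\mathcal A)$ with respect to $\|\cdot\|_{\rm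 u}$, let $\kappa^{\mathcal A}\colon C_c(\mathcal A)\to C^*(\mathcal A)$ be the canonical map, and put $\widehat j^{\mathcal A}_g=\kappa^{\mathcal A}\circ j^{\mathcal A}_g$; similarly for $\mathcal B$. Let $T=(T_g)_{g\in G}$ be an $\mathcal A$-$\varphi$-$\mathcal B$ bundle map, i.e. a family of bounded linear maps $T_g\colon A_g\to B_{\varphi(g)}$. Call $T$ positive definite if $$\sum_{i,j=1}^n b_i\,T_{g_i^{-1}g_j}(a_i^*a_j)\,b_j^*\in (B_e)^+$$ for all $n\in\mathbb N$, $g_1,\dots,g_n\in G$, $a_i\in A_{g_i}$ and $b_i\in B_{\varphi(g_i)}$. Let $\phi_T\colon C_c(\mathcal A)\to C_c(\mathcal B)$ be the linear map with $\phi_T(j^{\mathcal A}_g(a))=j^{\mathcal B}_{\varphi(g)}(T_g(a))$ for all $g\in G$, $a\in A_g$. Call $T$ full if $\phi_T$ is bounded with respect to the norms $\|\cdot\|_{\rm u}$ on $C_c(\mathcal A)$ and $C_c(\mathcal B)$; in that case let $\Phi_T\colon C^*(\mathcal A)\to C^*(\mathcal B)$ be its bounded linear extension, which satisfies $\Phi_T(\widehat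 j^{\mathcal A}_g(a))=\widehat j^{\mathcal B}_{\varphi(g)}(T_g(a))$ for all $g\in G$ and $a\in A_g$. Then $T$ is positive definite if and only if $T$ is full and $\Phi_T$ is completely positive. In that case, $\|\Phi_T\|=\|T_e\|$. -/

import Mathlib

noncomputable section

/-! ### C*-seminorms and the associated Hausdorff completion -/

/-- A C*-seminorm on a complex `*`-algebra: a submultiplicative seminorm satisfying the
C*-identity. (Invariance under the involution follows, see `CStarSeminorm.map_star`.) -/
structure CStarSeminorm (R : Type*) [NonUnitalRing R] [StarRing R] [Module ℂ R] extends
    Seminorm ℂ R where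
  mul_le' : ∀ x y, toFun (x * y) ≤ toFun x * toFun y
  star_mul_self' : ∀ x, toFun (star x * x) = toFun x ^ 2

namespace CStarSeminorm

section

variable {R : Type*} [NonUnitalRing R] [StarRing R] [Module ℂ R]

instance : CoeFun (CStarSeminorm R) (fun _ => R → ℝ) := ⟨fun p => p.toSeminorm⟩

lemma mul_le (p : CStarSeminorm R) (x y : R) : p (x * y) ≤ p x * p y := p.mul_le' x y

lemma star_mul_self (p : CStarSeminorm R) (x : R) : p (star x * x) = p x ^ 2 :=
  p.star_mul_self' x

lemma le_map_star (p : CStarSeminorm R) (x : R) : p x ≤ p (star x) := by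
  by_contra! h
  have h0 : 0 ≤ p (star x) := apply_nonneg p.toSeminorm _
  have h1 := p.mul_le (star x) x
  rw [p.star_mul_self] at h1
  nlinarith

lemma map_star (p : CStarSeminorm R) (x : R) : p (star x) = p x :=
  le_antisymm (by simpa using p.le_map_star (star x)) (p.le_map_star x)

/-- The algebra `R`, regarded as a seminormed algebra through the C*-seminorm `p`. -/
def Pre (_p : CStarSeminorm R) : Type _ := R

variable (p : CStarSeminorm R)

instance : NonUnitalSeminormedRing p.Pre :=
  { (inferInstance : NonUnitalRing R),
    p.toSeminorm.toAddGroupSeminorm.toSeminormedAddCommGroup with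
    norm_mul_le := fun x y => p.mul_le x y }

instance : StarRing p.Pre := inferInstanceAs (StarRing R)

instance : Module ℂ p.Pre := inferInstanceAs (Module ℂ R)

instance : NormedSpace ℂ p.Pre where
  norm_smul_le c x := (map_smul_eq_mul p.toSeminorm c x).le

instance : NormedStarGroup p.Pre where
  norm_star_le x := (p.map_star x).le

/-- The Hausdorff completion of `R` with respect to the C*-seminorm `p`. -/
def Completion : Type _ := UniformSpace.Completion p.Pre

instance : NormedAddCommGroup p.Completion :=
  inferInstanceAs (NormedAddCommGroup (UniformSpace.Completion p.Pre))
instance : NormedSpace ℂ p.Completion :=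
  inferInstanceAs (NormedSpace ℂ (UniformSpace.Completion p.Pre))
instance : CompleteSpace p.Completion :=
  inferInstanceAs (CompleteSpace (UniformSpace.Completion p.Pre))

/-- The canonical additive map from the seminormed copy of `R` to the completion. -/
def incl : p.Pre →+ p.Completion := UniformSpace.Completion.toCompl (α := p.Pre)

/-- The canonical linear map from `R` to its completion. -/
def toCompletion : R →ₗ[ℂ] p.Completion where
  toFun x := p.incl x
  map_add' x y := p.incl.map_add x y
  map_smul' c x := UniformSpace.Completion.coe_smul (X := p.Pre) c x

lemma norm_toCompletion (x : R) : ‖p.toCompletion x‖ = p x :=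
  UniformSpace.Completion.norm_coe (E := p.Pre) x

lemma isDenseInducing_incl : IsDenseInducing p.incl :=
  UniformSpace.Completion.isDenseInducing_coe (α := p.Pre)

lemma continuous_incl : Continuous p.incl :=
  p.isDenseInducing_incl.continuous

lemma denseRange_toCompletion : DenseRange p.toCompletion :=
  p.isDenseInducing_incl.dense

@[elab_as_elim]
lemma completion_induction {P : p.Completion → Prop} (x : p.Completion)
    (hc : IsClosed {x | P x}) (h : ∀ r, P (p.toCompletion r)) : P x :=
  p.denseRange_toCompletion.induction_on x hc h

instance : Mul p.Completion :=
  ⟨Function.curry <| (p.isDenseInducing_incl.prodMap p.isDenseInducing_incl).extend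
    (p.incl ∘ Function.uncurry fun x y : p.Pre => x * y)⟩

instance : Star p.Completion :=
  ⟨UniformSpace.Completion.map (star : p.Pre → p.Pre)⟩

lemma toCompletion_mul (x y : R) :
    p.toCompletion (x * y) = p.toCompletion x * p.toCompletion y :=
  ((p.isDenseInducing_incl.prodMap p.isDenseInducing_incl).extend_eq
    (p.continuous_incl.comp (continuous_mul (M := p.Pre))) (x, y)).symm

lemma toCompletion_star (x : R) : p.toCompletion (star x) = star (p.toCompletion x) :=
  (UniformSpace.Completion.map_coe (α := p.Pre) (β := p.Pre) (f := star)
    (starNormedAddGroupHom.uniformContinuous) x).symm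

instance : ContinuousMul p.Completion where
  continuous_mul := by
    let m : p.Pre →+ p.Pre →+ p.Completion :=
      (AddMonoidHom.mul : p.Pre →+ p.Pre →+ p.Pre).compr₂ p.incl
    have : Continuous fun q : p.Pre × p.Pre => m q.1 q.2 :=
      p.continuous_incl.comp continuous_mul
    exact (p.isDenseInducing_incl.extend_Z_bilin p.isDenseInducing_incl this :)

instance : ContinuousStar p.Completion where
  continuous_star := UniformSpace.Completion.continuous_map (α := p.Pre) (β := p.Pre)

@[elab_as_elim]
lemma completion_induction₂ {P : p.Completion → p.Completion → Prop} (x y : p.Completion)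
    (hc : IsClosed {q : p.Completion × p.Completion | P q.1 q.2})
    (h : ∀ r s, P (p.toCompletion r) (p.toCompletion s)) : P x y :=
  p.denseRange_toCompletion.induction_on₂ hc h x y

@[elab_as_elim]
lemma completion_induction₃ {P : p.Completion → p.Completion → p.Completion → Prop}
    (x y z : p.Completion)
    (hc : IsClosed {q : p.Completion × p.Completion × p.Completion | P q.1 q.2.1 q.2.2})
    (h : ∀ r s t, P (p.toCompletion r) (p.toCompletion s) (p.toCompletion t)) : P x y z :=
  p.denseRange_toCompletion.induction_on₃ hc h x y z

instance : NonUnitalNormedRing p.Completion where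
  __ := (inferInstance : NormedAddCommGroup p.Completion)
  __ := (inferInstance : Mul p.Completion)
  zero_mul x := by
    induction x using p.completion_induction with
    | hc => exact isClosed_eq (by fun_prop) (by fun_prop)
    | h r => rw [← map_zero p.toCompletion, ← toCompletion_mul, zero_mul]
  mul_zero x := by
    induction x using p.completion_induction with
    | hc => exact isClosed_eq (by fun_prop) (by fun_prop)
    | h r => rw [← map_zero p.toCompletion, ← toCompletion_mul, mul_zero]
  left_distrib x y z := by
    induction x, y, z using p.completion_induction₃ with
    | hc => exact isClosed_eq (by fun_prop) (by fun_prop)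
    | h r s t => simp only [← map_add, ← toCompletion_mul, mul_add]
  right_distrib x y z := by
    induction x, y, z using p.completion_induction₃ with
    | hc => exact isClosed_eq (by fun_prop) (by fun_prop)
    | h r s t => simp only [← map_add, ← toCompletion_mul, add_mul]
  mul_assoc x y z := by
    induction x, y, z using p.completion_induction₃ with
    | hc => exact isClosed_eq (by fun_prop) (by fun_prop)
    | h r s t => simp only [← toCompletion_mul, mul_assoc]
  norm_mul_le x y := by
    induction x, y using p.completion_induction₂ with
    | hc => exact isClosed_le (by fun_prop) (by fun_prop)
    | h r s => simpa only [← toCompletion_mul, norm_toCompletion] using p.mul_le r s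

instance : StarRing p.Completion where
  star_involutive x := by
    induction x using p.completion_induction with
    | hc => exact isClosed_eq (by fun_prop) (by fun_prop)
    | h r => simp only [← toCompletion_star, star_star]
  star_mul x y := by
    induction x, y using p.completion_induction₂ with
    | hc => exact isClosed_eq (by fun_prop) (by fun_prop)
    | h r s => simp only [← toCompletion_star, ← toCompletion_mul, star_mul]
  star_add x y := by
    induction x, y using p.completion_induction₂ with
    | hc => exact isClosed_eq (by fun_prop) (by fun_prop)
    | h r s => simp only [← toCompletion_star, ← map_add, star_add]

end

section

variable {R : Type*} [NonUnitalRing R] [StarRing R] [Module ℂ R] [IsScalarTower ℂ R R]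
  [SMulCommClass ℂ R R] [StarModule ℂ R] (p : CStarSeminorm R)

instance : IsScalarTower ℂ p.Completion p.Completion where
  smul_assoc c x y := by
    change (c • x) * y = c • (x * y)
    induction x, y using p.completion_induction₂ with
    | hc =>
      exact isClosed_eq ((continuous_fst.const_smul c).mul continuous_snd)
        ((continuous_fst.mul continuous_snd).const_smul c)
    | h r s => simp only [← map_smul, ← toCompletion_mul, smul_mul_assoc]

instance : SMulCommClass ℂ p.Completion p.Completion where
  smul_comm c x y := by
    change c • (x * y) = x * (c • y)
    induction x, y using p.completion_induction₂ with
    | hc =>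
      exact isClosed_eq ((continuous_fst.mul continuous_snd).const_smul c)
        (continuous_fst.mul (continuous_snd.const_smul c))
    | h r s => simp only [← map_smul, ← toCompletion_mul, mul_smul_comm]

instance : StarModule ℂ p.Completion where
  star_smul c x := by
    induction x using p.completion_induction with
    | hc => exact isClosed_eq (continuous_id.const_smul c).star (continuous_id.star.const_smul (star c))
    | h r => simp only [← map_smul, ← toCompletion_star, star_smul]

instance : CStarRing p.Completion where
  norm_mul_self_le x := by
    induction x using p.completion_induction with
    | hc => exact isClosed_le (by fun_prop) (by fun_prop)
    | h r =>
      rw [← toCompletion_star, ← toCompletion_mul, norm_toCompletion, norm_toCompletion,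
        p.star_mul_self, sq]

/-- The Hausdorff completion for a C*-seminorm is a C*-algebra. -/
instance : NonUnitalCStarAlgebra p.Completion where

/-- The order given by the cone of positive elements. -/
instance : PartialOrder p.Completion := CStarAlgebra.spectralOrder _

instance : StarOrderedRing p.Completion := CStarAlgebra.spectralOrderedRing _

end

end CStarSeminorm

/-! ### Fell bundles over discrete groups -/

universe u v

/-- All the data and axioms of a Fell bundle over a discrete group, except for the positivity of
`a⋆ a` in the unit fibre, which is added in `FellBundle` once the unit fibre is known to be a
C*-algebra. The product of `a ∈ A_g` and `b ∈ A_h` lies in `A_{gh}`; so as not to transport elements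
along equalities between group elements, `fmul` takes a name `k` for the element `g * h`, together
with the proof of `g * h = k`. Similarly for the involution, which maps `A_g` into `A_{g⁻¹}`. -/
structure PreFellBundle (G : Type u) [Group G] where
  /-- the fibres -/
  fiber : G → Type v
  [normedAddCommGroup : ∀ g, NormedAddCommGroup (fiber g)]
  [normedSpace : ∀ g, NormedSpace ℂ (fiber g)]
  [completeSpace : ∀ g, CompleteSpace (fiber g)]
  /-- the multiplication -/
  fmul : ∀ {g h k : G}, g * h = k → fiber g → fiber h → fiber k
  /-- the involution -/
  fstar : ∀ {g k : G}, g⁻¹ = k → fiber g → fiber k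
  fadd_mul : ∀ {g h k : G} (e : g * h = k) (a a' : fiber g) (b : fiber h),
    fmul e (a + a') b = fmul e a b + fmul e a' b
  fmul_add : ∀ {g h k : G} (e : g * h = k) (a : fiber g) (b b' : fiber h),
    fmul e a (b + b') = fmul e a b + fmul e a b'
  fsmul_mul : ∀ {g h k : G} (e : g * h = k) (c : ℂ) (a : fiber g) (b : fiber h),
    fmul e (c • a) b = c • fmul e a b
  fmul_smul : ∀ {g h k : G} (e : g * h = k) (c : ℂ) (a : fiber g) (b : fiber h),
    fmul e a (c • b) = c • fmul e a b
  fmul_assoc : ∀ {g h k gh hk ghk : G} (e₁ : g * h = gh) (e₂ : gh * k = ghk) (e₃ : h * k = hk)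
    (e₄ : g * hk = ghk) (a : fiber g) (b : fiber h) (c : fiber k),
    fmul e₂ (fmul e₁ a b) c = fmul e₄ a (fmul e₃ b c)
  norm_fmul_le : ∀ {g h k : G} (e : g * h = k) (a : fiber g) (b : fiber h),
    ‖fmul e a b‖ ≤ ‖a‖ * ‖b‖
  fstar_add : ∀ {g k : G} (e : g⁻¹ = k) (a b : fiber g),
    fstar e (a + b) = fstar e a + fstar e b
  fstar_smul : ∀ {g k : G} (e : g⁻¹ = k) (c : ℂ) (a : fiber g),
    fstar e (c • a) = star c • fstar e a
  fstar_fstar : ∀ {g k : G} (e₁ : g⁻¹ = k) (e₂ : k⁻¹ = g) (a : fiber g),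
    fstar e₂ (fstar e₁ a) = a
  fstar_mul : ∀ {g h k g' h' k' : G} (e : g * h = k) (eg : g⁻¹ = g') (eh : h⁻¹ = h')
    (ek : k⁻¹ = k') (e' : h' * g' = k') (a : fiber g) (b : fiber h),
    fstar ek (fmul e a b) = fmul e' (fstar eh b) (fstar eg a)
  norm_fstar : ∀ {g k : G} (e : g⁻¹ = k) (a : fiber g), ‖fstar e a‖ = ‖a‖
  norm_fstar_mul_self : ∀ {g k : G} (e : g⁻¹ = k) (e' : k * g = 1) (a : fiber g),
    ‖fmul e' (fstar e a) a‖ = ‖a‖ ^ 2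

attribute [instance] PreFellBundle.normedAddCommGroup PreFellBundle.normedSpace
  PreFellBundle.completeSpace

namespace PreFellBundle

variable {G : Type u} [Group G] (𝒜 : PreFellBundle.{u, v} G)

lemma fzero_mul {g h k : G} (e : g * h = k) (b : 𝒜.fiber h) : 𝒜.fmul e 0 b = 0 := by
  simpa using 𝒜.fsmul_mul e 0 0 b

lemma fmul_zero {g h k : G} (e : g * h = k) (a : 𝒜.fiber g) : 𝒜.fmul e a 0 = 0 := by
  simpa using 𝒜.fmul_smul e 0 a 0

lemma fstar_zero {g k : G} (e : g⁻¹ = k) : 𝒜.fstar e 0 = 0 := by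
  simpa using 𝒜.fstar_smul e 0 0

/-- The unit fibre is a C*-algebra. -/
instance : NonUnitalNormedRing (𝒜.fiber 1) :=
  { 𝒜.normedAddCommGroup 1 with
    mul := 𝒜.fmul (one_mul 1)
    zero_mul := 𝒜.fzero_mul _
    mul_zero := 𝒜.fmul_zero _
    left_distrib := 𝒜.fmul_add _
    right_distrib := 𝒜.fadd_mul _
    mul_assoc := 𝒜.fmul_assoc _ _ _ _
    norm_mul_le := 𝒜.norm_fmul_le _ }

instance : StarRing (𝒜.fiber 1) where
  star := 𝒜.fstar inv_one
  star_involutive := 𝒜.fstar_fstar _ _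
  star_mul := 𝒜.fstar_mul _ _ _ _ _
  star_add := 𝒜.fstar_add _

lemma unitFiber_mul_def (a b : 𝒜.fiber 1) : a * b = 𝒜.fmul (one_mul 1) a b := rfl

lemma unitFiber_star_def (a : 𝒜.fiber 1) : star a = 𝒜.fstar inv_one a := rfl

instance : NonUnitalCStarAlgebra (𝒜.fiber 1) where
  norm_mul_self_le a := by
    rw [unitFiber_mul_def, unitFiber_star_def, 𝒜.norm_fstar_mul_self, sq]
  smul_assoc c a b := 𝒜.fsmul_mul _ c a b
  smul_comm c a b := (𝒜.fmul_smul _ c a b).symm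
  star_smul c a := 𝒜.fstar_smul _ c a

/-- The order given by the cone of positive elements of the C*-algebra `A_e`. -/
instance : PartialOrder (𝒜.fiber 1) := CStarAlgebra.spectralOrder _

instance : StarOrderedRing (𝒜.fiber 1) := CStarAlgebra.spectralOrderedRing _

/-! #### The `*`-algebra of finitely supported sections -/

/-- The space `C_c(𝒜)` of finitely supported sections of the bundle. -/
def Sections : Type (max u v) := Π₀ g, 𝒜.fiber g

instance : AddCommGroup 𝒜.Sections := inferInstanceAs (AddCommGroup (Π₀ g, 𝒜.fiber g))
instance : Module ℂ 𝒜.Sections := inferInstanceAs (Module ℂ (Π₀ g, 𝒜.fiber g))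
instance : DFunLike 𝒜.Sections G 𝒜.fiber := inferInstanceAs (DFunLike (Π₀ g, 𝒜.fiber g) G 𝒜.fiber)

open Classical in
/-- The canonical injection `j_g : A_g → C_c(𝒜)`. -/
def j (g : G) : 𝒜.fiber g →ₗ[ℂ] 𝒜.Sections := DFinsupp.lsingle g

open Classical in
/-- The linear map on `C_c(𝒜)` determined by a family of linear maps on the fibres. -/
def lift {N : Type*} [AddCommGroup N] [Module ℂ N] (F : ∀ g, 𝒜.fiber g →ₗ[ℂ] N) :
    𝒜.Sections →ₗ[ℂ] N := DFinsupp.lsum ℂ F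

@[simp]
lemma lift_j {N : Type*} [AddCommGroup N] [Module ℂ N] (F : ∀ g, 𝒜.fiber g →ₗ[ℂ] N) (g : G)
    (a : 𝒜.fiber g) : 𝒜.lift F (𝒜.j g a) = F g a := by
  classical
  exact DFinsupp.lsum_single _ _ _ _

@[elab_as_elim]
lemma sections_induction {P : 𝒜.Sections → Prop} (f : 𝒜.Sections) (h0 : P 0)
    (hj : ∀ g a, P (𝒜.j g a)) (hadd : ∀ f₁ f₂, P f₁ → P f₂ → P (f₁ + f₂)) : P f := by
  classical
  exact DFinsupp.induction f h0 fun g a f _ _ hf => hadd _ _ (hj g a) hf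

lemma j_apply_self (g : G) (a : 𝒜.fiber g) : 𝒜.j g a g = a := by
  classical
  exact DFinsupp.single_eq_same

lemma j_apply_of_ne {g h : G} (hne : h ≠ g) (a : 𝒜.fiber g) : 𝒜.j g a h = 0 := by
  classical
  exact DFinsupp.single_eq_of_ne hne

lemma add_apply (f₁ f₂ : 𝒜.Sections) (g : G) : (f₁ + f₂) g = f₁ g + f₂ g :=
  DFinsupp.add_apply _ _ _

lemma zero_apply (g : G) : (0 : 𝒜.Sections) g = 0 := rfl

/-- The multiplication `A_g × A_h → A_{gh}` as a bilinear map. -/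
def fmulₗ (g h : G) : 𝒜.fiber g →ₗ[ℂ] 𝒜.fiber h →ₗ[ℂ] 𝒜.fiber (g * h) :=
  LinearMap.mk₂ ℂ (𝒜.fmul rfl) (𝒜.fadd_mul rfl) (𝒜.fsmul_mul rfl) (𝒜.fmul_add rfl)
    (𝒜.fmul_smul rfl)

/-- The convolution product as a bilinear map. -/
def convₗ : 𝒜.Sections →ₗ[ℂ] 𝒜.Sections →ₗ[ℂ] 𝒜.Sections :=
  𝒜.lift fun g => (𝒜.lift fun h => ((𝒜.fmulₗ g h).compr₂ (𝒜.j (g * h))).flip).flip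

/-- The convolution product on `C_c(𝒜)`; see `PreFellBundle.mul_apply` for the pointwise formula. -/
instance : Mul 𝒜.Sections := ⟨fun f₁ f₂ => 𝒜.convₗ f₁ f₂⟩

/-- The involution on `C_c(𝒜)`; see `PreFellBundle.star_apply` for the pointwise formula. -/
def starHom : 𝒜.Sections →+ 𝒜.Sections := by
  classical
  exact DFinsupp.sumAddHom fun g => (𝒜.j g⁻¹).toAddMonoidHom.comp
    (AddMonoidHom.mk' (𝒜.fstar rfl) (𝒜.fstar_add rfl))

instance : Star 𝒜.Sections := ⟨𝒜.starHom⟩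

lemma j_mul_j {g h k : G} (e : g * h = k) (a : 𝒜.fiber g) (b : 𝒜.fiber h) :
    𝒜.j g a * 𝒜.j h b = 𝒜.j k (𝒜.fmul e a b) := by
  subst e
  change 𝒜.convₗ (𝒜.j g a) (𝒜.j h b) = _
  simp [convₗ, fmulₗ]

lemma star_j {g k : G} (e : g⁻¹ = k) (a : 𝒜.fiber g) :
    star (𝒜.j g a) = 𝒜.j k (𝒜.fstar e a) := by
  classical
  subst e
  exact DFinsupp.sumAddHom_single _ _ _

lemma conv_add (f₁ f₂ f₃ : 𝒜.Sections) : f₁ * (f₂ + f₃) = f₁ * f₂ + f₁ * f₃ :=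
  map_add (𝒜.convₗ f₁) f₂ f₃

lemma add_conv (f₁ f₂ f₃ : 𝒜.Sections) : (f₁ + f₂) * f₃ = f₁ * f₃ + f₂ * f₃ :=
  LinearMap.map_add₂ 𝒜.convₗ f₁ f₂ f₃

lemma conv_zero (f : 𝒜.Sections) : f * 0 = 0 := map_zero (𝒜.convₗ f)

lemma zero_conv (f : 𝒜.Sections) : 0 * f = 0 := LinearMap.map_zero₂ 𝒜.convₗ f

instance : NonUnitalRing 𝒜.Sections :=
  { (inferInstance : AddCommGroup 𝒜.Sections), (inferInstance : Mul 𝒜.Sections) with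
    zero_mul := 𝒜.zero_conv
    mul_zero := 𝒜.conv_zero
    left_distrib := 𝒜.conv_add
    right_distrib := 𝒜.add_conv
    mul_assoc := fun f₁ f₂ f₃ => by
      induction f₁ using 𝒜.sections_induction with
      | h0 => simp only [zero_conv]
      | hadd f f' hf hf' => simp only [add_conv, hf, hf']
      | hj g a =>
      induction f₂ using 𝒜.sections_induction with
      | h0 => simp only [zero_conv, conv_zero]
      | hadd f f' hf hf' => simp only [add_conv, conv_add, hf, hf']
      | hj h b =>
      induction f₃ using 𝒜.sections_induction with
      | h0 => simp only [conv_zero]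
      | hadd f f' hf hf' => simp only [conv_add, hf, hf']
      | hj k c =>
        rw [𝒜.j_mul_j rfl, 𝒜.j_mul_j rfl, 𝒜.j_mul_j rfl, 𝒜.j_mul_j (mul_assoc g h k).symm,
          𝒜.fmul_assoc rfl rfl rfl] }

lemma star_add' (f₁ f₂ : 𝒜.Sections) : star (f₁ + f₂) = star f₁ + star f₂ :=
  map_add 𝒜.starHom f₁ f₂

lemma star_zero' : star (0 : 𝒜.Sections) = 0 := map_zero 𝒜.starHom

instance : StarRing 𝒜.Sections where
  star_involutive f := by
    induction f using 𝒜.sections_induction with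
    | h0 => simp only [star_zero']
    | hadd f f' hf hf' => simp only [star_add', hf, hf']
    | hj g a => rw [𝒜.star_j rfl, 𝒜.star_j (inv_inv g), 𝒜.fstar_fstar]
  star_add := 𝒜.star_add'
  star_mul f₁ f₂ := by
    induction f₁ using 𝒜.sections_induction with
    | h0 => simp only [star_zero', zero_mul, mul_zero]
    | hadd f f' hf hf' => simp only [star_add', add_mul, mul_add, hf, hf']
    | hj g a =>
    induction f₂ using 𝒜.sections_induction with
    | h0 => simp only [star_zero', zero_mul, mul_zero]
    | hadd f f' hf hf' => simp only [star_add', add_mul, mul_add, hf, hf']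
    | hj h b =>
      rw [𝒜.j_mul_j rfl, 𝒜.star_j rfl, 𝒜.star_j rfl, 𝒜.star_j rfl,
        𝒜.j_mul_j (mul_inv_rev g h).symm, 𝒜.fstar_mul rfl rfl rfl]

instance : IsScalarTower ℂ 𝒜.Sections 𝒜.Sections where
  smul_assoc c f₁ f₂ := LinearMap.map_smul₂ 𝒜.convₗ c f₁ f₂

instance : SMulCommClass ℂ 𝒜.Sections 𝒜.Sections where
  smul_comm c f₁ f₂ := (map_smul (𝒜.convₗ f₁) c f₂).symm

instance : StarModule ℂ 𝒜.Sections where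
  star_smul c f := by
    induction f using 𝒜.sections_induction with
    | h0 => simp only [smul_zero, star_zero']
    | hadd f f' hf hf' => simp only [smul_add, star_add', hf, hf']
    | hj g a => rw [← map_smul, 𝒜.star_j rfl, 𝒜.star_j rfl, 𝒜.fstar_smul, map_smul]

/-- The involution of `C_c(𝒜)` is given by `f⋆(h) = f(h⁻¹)⋆`. -/
lemma star_apply (f : 𝒜.Sections) (h : G) :
    (star f) h = 𝒜.fstar (inv_inv h) (f h⁻¹) := by
  induction f using 𝒜.sections_induction with
  | h0 => rw [star_zero', zero_apply, zero_apply, fstar_zero]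
  | hadd f f' hf hf' => rw [star_add', add_apply, add_apply, hf, hf', fstar_add]
  | hj g a =>
    by_cases hg : h⁻¹ = g
    · subst hg
      rw [𝒜.star_j (inv_inv h), j_apply_self, j_apply_self]
    · rw [𝒜.star_j rfl, 𝒜.j_apply_of_ne hg, 𝒜.j_apply_of_ne (by rintro rfl; simp at hg),
        fstar_zero]

/-- The product of `C_c(𝒜)` is given by `(f₁ * f₂)(h) = ∑_g f₁(g) f₂(g⁻¹h)`. -/
lemma mul_apply (f₁ f₂ : 𝒜.Sections) (h : G) :
    (f₁ * f₂) h = ∑ᶠ g, 𝒜.fmul (mul_inv_cancel_left g h) (f₁ g) (f₂ (g⁻¹ * h)) := by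
  have hfin : ∀ f : 𝒜.Sections,
      {g | 𝒜.fmul (mul_inv_cancel_left g h) (f g) (f₂ (g⁻¹ * h)) ≠ 0}.Finite := by
    intro f
    refine (DFinsupp.finite_support f).subset fun g hg h0 => hg ?_
    change f g = 0 at h0
    rw [h0, fzero_mul]
  induction f₁ using 𝒜.sections_induction with
  | h0 => simp only [zero_mul, zero_apply, fzero_mul, finsum_zero]
  | hadd f f' hf hf' =>
    rw [add_mul, add_apply, hf, hf', ← finsum_add_distrib (hfin f) (hfin f')]
    simp only [add_apply, fadd_mul]
  | hj g a =>
    rw [finsum_eq_single _ g fun k hk => by rw [𝒜.j_apply_of_ne hk, fzero_mul], j_apply_self]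
    clear hfin
    induction f₂ using 𝒜.sections_induction with
    | h0 => rw [mul_zero, zero_apply, zero_apply, fmul_zero]
    | hadd f f' hf hf' => rw [mul_add, add_apply, add_apply, fmul_add, hf, hf']
    | hj k b =>
      by_cases hk : g⁻¹ * h = k
      · subst hk
        rw [𝒜.j_mul_j (mul_inv_cancel_left g h), j_apply_self, j_apply_self]
      · rw [𝒜.j_mul_j rfl, 𝒜.j_apply_of_ne hk,
          𝒜.j_apply_of_ne (by rintro rfl; simp at hk), fmul_zero]

/-! #### The full cross-sectional C*-algebra -/

/-- The canonical map from the unit fibre to the completion of `C_c(𝒜)` for a C*-seminorm. -/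
def unitFiberHom (p : CStarSeminorm 𝒜.Sections) : 𝒜.fiber 1 →⋆ₙₐ[ℂ] p.Completion where
  toFun a := p.toCompletion (𝒜.j 1 a)
  map_smul' c a := by simp
  map_zero' := by simp
  map_add' a b := by simp
  map_mul' a b := by
    rw [← p.toCompletion_mul, 𝒜.j_mul_j (one_mul 1), unitFiber_mul_def]
  map_star' a := by
    rw [← p.toCompletion_star, 𝒜.star_j inv_one, unitFiber_star_def]

lemma seminorm_j_le (p : CStarSeminorm 𝒜.Sections) (g : G) (a : 𝒜.fiber g) :
    p (𝒜.j g a) ≤ ‖a‖ := by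
  have h1 : ∀ b : 𝒜.fiber 1, p (𝒜.j 1 b) ≤ ‖b‖ := fun b => by
    rw [← p.norm_toCompletion]
    exact NonUnitalStarAlgHom.norm_apply_le (𝒜.unitFiberHom p) b
  have h2 := h1 (𝒜.fmul (inv_mul_cancel g) (𝒜.fstar rfl a) a)
  rw [← 𝒜.j_mul_j, ← 𝒜.star_j, p.star_mul_self, 𝒜.norm_fstar_mul_self] at h2
  exact le_of_sq_le_sq h2 (norm_nonneg a)

lemma bddAbove_seminorms (f : 𝒜.Sections) :
    BddAbove (Set.range fun p : CStarSeminorm 𝒜.Sections => p f) := by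
  suffices ∃ C, ∀ p : CStarSeminorm 𝒜.Sections, p f ≤ C by
    obtain ⟨C, hC⟩ := this
    exact ⟨C, Set.forall_mem_range.2 hC⟩
  induction f using 𝒜.sections_induction with
  | h0 => exact ⟨0, fun p => (map_zero p.toSeminorm).le⟩
  | hj g a => exact ⟨‖a‖, fun p => 𝒜.seminorm_j_le p g a⟩
  | hadd f f' hf hf' =>
    obtain ⟨C, hC⟩ := hf
    obtain ⟨C', hC'⟩ := hf'
    exact ⟨C + C', fun p => (map_add_le_add p.toSeminorm f f').trans (add_le_add (hC p) (hC' p))⟩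

instance : Nonempty (CStarSeminorm 𝒜.Sections) :=
  ⟨{ (0 : Seminorm ℂ 𝒜.Sections) with
      mul_le' := fun _ _ => (mul_zero (0 : ℝ)).ge
      star_mul_self' := fun _ => (zero_pow two_ne_zero).symm }⟩

lemma seminorm_le_iSup (p : CStarSeminorm 𝒜.Sections) (f : 𝒜.Sections) :
    p f ≤ ⨆ q : CStarSeminorm 𝒜.Sections, q f :=
  le_ciSup (𝒜.bddAbove_seminorms f) p

lemma iSup_seminorm_nonneg (f : 𝒜.Sections) : 0 ≤ ⨆ q : CStarSeminorm 𝒜.Sections, q f :=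
  Real.iSup_nonneg fun q => apply_nonneg q.toSeminorm f

/-- The universal C*-norm on `C_c(𝒜)`: the supremum of all C*-seminorms. -/
def universalNorm : CStarSeminorm 𝒜.Sections :=
  { Seminorm.of (𝕜 := ℂ) (fun f => ⨆ p : CStarSeminorm 𝒜.Sections, p f)
      (fun f₁ f₂ => ciSup_le fun p => (map_add_le_add p.toSeminorm f₁ f₂).trans
        (add_le_add (𝒜.seminorm_le_iSup p f₁) (𝒜.seminorm_le_iSup p f₂)))
      (fun c f => by
        simp only [map_smul_eq_mul]
        rw [Real.mul_iSup_of_nonneg (norm_nonneg c)]) with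
    mul_le' := fun f₁ f₂ => ciSup_le fun p => (p.mul_le f₁ f₂).trans
      (mul_le_mul (𝒜.seminorm_le_iSup p f₁) (𝒜.seminorm_le_iSup p f₂)
        (apply_nonneg p.toSeminorm f₂) (𝒜.iSup_seminorm_nonneg f₁))
    star_mul_self' := fun f => by
      refine le_antisymm (ciSup_le fun p => ?_) ?_
      · rw [p.star_mul_self]
        exact pow_le_pow_left₀ (apply_nonneg p.toSeminorm f) (𝒜.seminorm_le_iSup p f) 2
      · refine (Real.le_sqrt (𝒜.iSup_seminorm_nonneg f) (𝒜.iSup_seminorm_nonneg _)).1 ?_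
        refine ciSup_le fun p => Real.le_sqrt_of_sq_le ?_
        rw [← p.star_mul_self]
        exact 𝒜.seminorm_le_iSup p _ }

lemma universalNorm_apply (f : 𝒜.Sections) :
    𝒜.universalNorm f = ⨆ p : CStarSeminorm 𝒜.Sections, p f := rfl

/-- The full cross-sectional C*-algebra `C*(𝒜)`: the completion of `C_c(𝒜)` with respect to the
universal C*-norm. -/
abbrev FullCStarAlgebra : Type (max u v) := 𝒜.universalNorm.Completion

/-- The canonical map `κ : C_c(𝒜) → C*(𝒜)`. -/
def κ : 𝒜.Sections →ₗ[ℂ] 𝒜.FullCStarAlgebra := 𝒜.universalNorm.toCompletion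

/-- The canonical map `ĵ_g = κ ∘ j_g : A_g → C*(𝒜)`. -/
def jHat (g : G) : 𝒜.fiber g →ₗ[ℂ] 𝒜.FullCStarAlgebra := 𝒜.κ ∘ₗ 𝒜.j g

/-- The positivity axiom of a Fell bundle: `a⋆ a` is a positive element of the C*-algebra `A_e`,
for all `g ∈ G` and `a ∈ A_g`. -/
def StarMulSelfNonneg : Prop :=
  ∀ (g : G) (a : 𝒜.fiber g), 0 ≤ 𝒜.fmul (inv_mul_cancel g) (𝒜.fstar rfl a) a

end PreFellBundle

/-- A Fell bundle over a discrete group `G`. -/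
structure FellBundle (G : Type u) [Group G] extends PreFellBundle.{u, v} G where
  starMulSelfNonneg : toPreFellBundle.StarMulSelfNonneg

/-! ### Bundle maps -/

/-- An `𝒜`-`φ`-`ℬ` bundle map: a family of bounded linear maps `T_g : A_g → B_{φ(g)}`. -/
structure BundleMap {G H : Type*} [Group G] [Group H] (𝒜 : FellBundle G) (φ : G →* H)
    (ℬ : FellBundle H) where
  /-- the bounded linear map `T_g` -/
  map : ∀ g : G, 𝒜.fiber g →L[ℂ] ℬ.fiber (φ g)

namespace BundleMap

variable {G H : Type*} [Group G] [Group H] {𝒜 : FellBundle G} {φ : G →* H} {ℬ : FellBundle H}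

/-- `T` is positive definite: `∑_{i,j} b_i T_{g_i⁻¹ g_j}(a_i⋆ a_j) b_j⋆ ∈ (B_e)⁺` for all
`g_1, …, g_n ∈ G`, `a_i ∈ A_{g_i}` and `b_i ∈ B_{φ(g_i)}`. -/
def IsPositiveDefinite (T : BundleMap 𝒜 φ ℬ) : Prop :=
  ∀ (n : ℕ) (g : Fin n → G) (a : ∀ i, 𝒜.fiber (g i)) (b : ∀ i, ℬ.fiber (φ (g i))),
    0 ≤ ∑ i, ∑ j, ℬ.fmul (mul_inv_cancel (φ (g j)))
      (ℬ.fmul (show φ (g i) * φ ((g i)⁻¹ * g j) = φ (g j) by rw [← map_mul, mul_inv_cancel_left])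
        (b i) (T.map ((g i)⁻¹ * g j) (𝒜.fmul rfl (𝒜.fstar rfl (a i)) (a j))))
      (ℬ.fstar rfl (b j))

/-- The linear map `φ_T : C_c(𝒜) → C_c(ℬ)` with `φ_T(j_g(a)) = j_{φ(g)}(T_g(a))`. -/
def sectionsMap (T : BundleMap 𝒜 φ ℬ) : 𝒜.Sections →ₗ[ℂ] ℬ.Sections :=
  𝒜.lift fun g => ℬ.j (φ g) ∘ₗ (T.map g).toLinearMap

/-- `T` is full: `φ_T` is bounded with respect to the universal C*-norms. -/
def IsFull (T : BundleMap 𝒜 φ ℬ) : Prop :=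
  ∃ C : ℝ, ∀ f : 𝒜.Sections, ℬ.universalNorm (T.sectionsMap f) ≤ C * 𝒜.universalNorm f

/-- For a full bundle map `T`, the bounded linear map `Φ_T : C*(𝒜) → C*(ℬ)` extending `φ_T`,
that is, with `Φ_T ∘ κ = κ ∘ φ_T`. -/
def fullExtension (T : BundleMap 𝒜 φ ℬ) : 𝒜.FullCStarAlgebra →L[ℂ] ℬ.FullCStarAlgebra :=
  (ℬ.κ ∘ₗ T.sectionsMap).extendOfNorm 𝒜.κ

lemma fullExtension_κ (T : BundleMap 𝒜 φ ℬ) (hT : T.IsFull) (f : 𝒜.Sections) :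
    T.fullExtension (𝒜.κ f) = ℬ.κ (T.sectionsMap f) := by
  obtain ⟨C, hC⟩ := hT
  refine LinearMap.extendOfNorm_eq 𝒜.universalNorm.denseRange_toCompletion ⟨C, fun f => ?_⟩ f
  have h := hC f
  rw [← CStarSeminorm.norm_toCompletion, ← CStarSeminorm.norm_toCompletion] at h
  exact h

end BundleMap

/-- A linear map between C*-algebras is completely positive, expressed through Mathlib's type of
completely positive maps. -/
def IsCompletelyPositive {A B : Type*} [NonUnitalCStarAlgebra A] [NonUnitalCStarAlgebra B]
    [PartialOrder A] [PartialOrder B] [StarOrderedRing A] [StarOrderedRing B]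
    (Φ : A →ₗ[ℂ] B) : Prop :=
  ∃ Ψ : CompletelyPositiveMap A B, Ψ.toLinearMap = Φ

end

set_option linter.unusedSectionVars false

open Filter Topology

/-! ### Functional calculus in non-unital C*-algebras -/

section FunctionalCalculus

variable {A : Type*} [NonUnitalCStarAlgebra A] [PartialOrder A] [StarOrderedRing A]

/-! If `T` is full and `Φ_T` is completely positive, applying `Φ_T` to the positive matrix `(a_i⋆
a_j)` gives positive definiteness. This requires that positivity in `B_e` can be tested in `C*(ℬ)`,
that is, that fibres embed isometrically (`universalNorm_j`).

The converse needs `∑ y_i T(a_i⋆ a_j) y_j⋆ ≥ 0` for arbitrary `y_i ∈ C*(ℬ)`, whereas the hypothesis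
only allows `y_i ∈ B_{φ(g_i)}`. The matrix `M = (T(a_i⋆ a_j))` lies in the C*-algebra `K` of
matrices with entries in `B_{φ(g_i)⁻¹φ(g_j)}`, so it suffices to test it on the rows of elements of
`K`, as its negative part is in `K` too. Row `s` has entries in `B_{φ(g_s⁻¹g_i)}`. Positive
definiteness applies to such a row once the `a_i` can be moved to `A_{g_s⁻¹g_i}`, which is possible
when they are multiplied on the left by an element of `a_s a_s⋆ A_e`
(`IsPositiveDefinite.isPositiveOnRow`). In general, functional calculus on `a_s a_s⋆` splits `M`
into a part of this kind and a part where `a_s` is negligible (`exists_split`). Induction over the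
indices treats all rows (`hasPositiveMatrix_aux`).

Boundedness is a GNS argument without a Hilbert module. For a completely positive form `Ψ`, the best
constants for left multiplication on the semi-inner product `Ψ(v⋆ w)` form a C*-seminorm, hence lie
below the universal norm. Cauchy-Schwarz and an approximate unit of `A_e` then bound `Ψ` by its norm
on `A_e` (`norm_completelyPositiveForm_le`). For `κ ∘ φ_T` this gives fullness and the norm formula;
for `f ↦ f(e)` it gives the isometric embedding of the fibres. -/

lemma mem_quasispectrum_nonneg_le_norm {r : A} (hr : 0 ≤ r) {t : ℝ}
    (ht : t ∈ quasispectrum ℝ r) : 0 ≤ t ∧ t ≤ ‖r‖ :=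
  ⟨quasispectrum_nonneg_of_nonneg r hr t ht,
    (le_abs_self t).trans (NonUnitalIsometricContinuousFunctionalCalculus.norm_quasispectrum_le
      (𝕜 := ℝ) r ht hr.isSelfAdjoint)⟩

/-- If `r` is positive, then `‖r‖ - r` is the square of `√‖r‖ + s` for a selfadjoint `s`. -/
lemma exists_isSelfAdjoint_norm_sub_eq_sq {r : A} (hr : 0 ≤ r) :
    ∃ s : A, IsSelfAdjoint s ∧ (2 * √‖r‖) • s + s * s = -r := by
  -- Subtracting `√‖r‖` makes `f` vanish at `0`, as the non-unital calculus requires.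
  let f : ℝ → ℝ := fun t => √(‖r‖ - t) - √‖r‖
  have hf : Continuous f := by fun_prop
  have hf0 : f 0 = 0 := by simp [f]
  refine ⟨cfcₙ f r, cfcₙ_predicate f r, ?_⟩
  rw [← cfcₙ_smul (2 * √‖r‖) f r, ← cfcₙ_mul f f r, ← cfcₙ_add ..]
  conv_rhs => rw [← cfcₙ_id ℝ r, ← cfcₙ_neg]
  refine cfcₙ_congr fun t ht => ?_
  have h := mem_quasispectrum_nonneg_le_norm hr ht
  have h1 : √(‖r‖ - t) ^ 2 = ‖r‖ - t := Real.sq_sqrt (by linarith)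
  have h2 : √‖r‖ ^ 2 = ‖r‖ := Real.sq_sqrt (norm_nonneg r)
  simp only [f, smul_eq_mul, id]
  linear_combination h1 - h2

/-- With `p t = t * m t = t² / (t² + ε²)` and `1 - v = √(1 - p²)`, the function `p` is close to `1`
away from `0`, and `t (1 - p²)` is small everywhere because `2tε ≤ t² + ε²`. -/
lemma exists_continuous_approximate_support {ε : ℝ} (hε : 0 < ε) :
    ∃ m v : ℝ → ℝ, Continuous m ∧ Continuous v ∧ m 0 = 0 ∧ v 0 = 0 ∧
      (∀ t, t * m t * (t * m t) + v t * v t = v t + v t) ∧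
      ∀ t, 0 ≤ t → t * (1 - v t) ^ 2 ≤ ε := by
  have hpos : ∀ t : ℝ, t ^ 2 + ε ^ 2 ≠ 0 := fun t => by positivity
  let m : ℝ → ℝ := fun t => t / (t ^ 2 + ε ^ 2)
  let p : ℝ → ℝ := fun t => t * m t
  have hm : Continuous m := by fun_prop (disch := exact hpos _)
  have hp : Continuous p := by fun_prop
  have hp1 : ∀ t, 0 ≤ 1 - p t ^ 2 := fun t => by
    have h : p t = t ^ 2 / (t ^ 2 + ε ^ 2) := by simp only [p, m]; ring
    have h1 : p t ≤ 1 := by rw [h, div_le_one (by positivity)]; nlinarith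
    have h2 : 0 ≤ p t := by rw [h]; positivity
    nlinarith
  have hsq : ∀ t, √(1 - p t ^ 2) ^ 2 = 1 - p t ^ 2 := fun t => Real.sq_sqrt (hp1 t)
  refine ⟨m, fun t => 1 - √(1 - p t ^ 2), hm, by fun_prop, by simp [m], by simp [p],
    fun t => by linear_combination hsq t, fun t ht0 => ?_⟩
  rw [sub_sub_cancel, hsq]
  have h2 : t * (1 - p t ^ 2) = t * ε ^ 2 * (2 * t ^ 2 + ε ^ 2) / (t ^ 2 + ε ^ 2) ^ 2 := by
    simp only [p, m]
    field_simp
    ring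
  rw [h2, div_le_iff₀ (by positivity)]
  have h3 : 0 ≤ ε * (t ^ 2 + ε ^ 2) * (t - ε) ^ 2 := by positivity
  nlinarith [mul_nonneg ht0 (pow_nonneg hε.le 4)]

/-- An approximate splitting `1 = p² + (1 - v)²` along a positive element `r`, where `p` is a
multiple of `r` and `(1 - v) r (1 - v)` is small. -/
lemma exists_approximate_support {r : A} (hr : 0 ≤ r) {ε : ℝ} (hε : 0 < ε) :
    ∃ p m v : A, IsSelfAdjoint p ∧ IsSelfAdjoint v ∧ p = r * m ∧ p * p + v * v = v + v ∧
      ‖r - v * r - r * v + v * r * v‖ ≤ ε := by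
  obtain ⟨m, v, hm, hv, hm0, hv0, hmv, hb⟩ := exists_continuous_approximate_support hε
  have hid : cfcₙ (id : ℝ → ℝ) r = r := cfcₙ_id ℝ r
  have hl : ∀ f : ℝ → ℝ, Continuous f → f 0 = 0 → cfcₙ f r * r = cfcₙ (fun t => f t * t) r :=
    fun f hf hf0 => by
      rw [cfcₙ_mul f (fun t => t) r hf.continuousOn hf0 continuousOn_id rfl]
      exact congrArg _ hid.symm
  have hr' : ∀ f : ℝ → ℝ, Continuous f → f 0 = 0 → r * cfcₙ f r = cfcₙ (fun t => t * f t) r :=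
    fun f hf hf0 => by
      rw [cfcₙ_mul (fun t => t) f r continuousOn_id rfl hf.continuousOn hf0]
      exact congrArg (· * cfcₙ f r) hid.symm
  refine ⟨cfcₙ (fun t => t * m t) r, cfcₙ m r, cfcₙ v r, cfcₙ_predicate _ r, cfcₙ_predicate v r,
    (hr' m hm hm0).symm, ?_, ?_⟩
  · rw [← cfcₙ_mul (fun t => t * m t) (fun t => t * m t) r, ← cfcₙ_mul v v r,
      ← cfcₙ_add _ _ r, ← cfcₙ_add v v r]
    exact cfcₙ_congr fun t _ => hmv t
  · have h : r - cfcₙ v r * r - r * cfcₙ v r + cfcₙ v r * r * cfcₙ v r =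
        cfcₙ (fun t => t - v t * t - t * v t + v t * t * v t) r := by
      rw [hl v hv hv0, hr' v hv hv0, ← cfcₙ_mul (fun t => v t * t) v r]
      nth_rw 1 [← hid]
      rw [← cfcₙ_sub id (fun t => v t * t) r, ← cfcₙ_sub _ (fun t => t * v t) r,
        ← cfcₙ_add _ (fun t => v t * t * v t) r]
      rfl
    rw [h]
    refine norm_cfcₙ_le fun t ht => ?_
    have ht0 := (mem_quasispectrum_nonneg_le_norm hr ht).1
    have h1 : t - v t * t - t * v t + v t * t * v t = t * (1 - v t) ^ 2 := by ring
    rw [h1, Real.norm_of_nonneg (mul_nonneg ht0 (sq_nonneg _))]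
    exact hb t ht0

end FunctionalCalculus

/-! ### Positivity of matrices over a C*-algebra -/

section FaithfulPositive

variable {E D ι : Type*} [NonUnitalCStarAlgebra E] [PartialOrder E] [StarOrderedRing E]

lemma exists_eq_star_mul_self_of_nonneg {x : E} (hx : 0 ≤ x) : ∃ y, x = star y * y :=
  CStarAlgebra.nonneg_iff_eq_star_mul_self.1 hx

variable [NonUnitalCStarAlgebra D]

/-- Polarization turns the hypothesis into `δ (x m y⋆) = 0`; then `x = m⋆` and `y = m⋆ m` give `δ (z
z⋆) = 0` for `z = m⋆ m`, and faithfulness applies. -/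
lemma eq_zero_of_forall_conj_eq_zero (K : NonUnitalStarSubalgebra ℂ E) (δ : ι → E →ₗ[ℂ] D)
    (hδ : ∀ x, (∀ s, δ s (x * star x) = 0) → x = 0) {m : E} (hm : m ∈ K)
    (h : ∀ x ∈ K, ∀ s, δ s (x * m * star x) = 0) : m = 0 := by
  have hpol : ∀ x ∈ K, ∀ y ∈ K, ∀ s, δ s (x * m * star y) = 0 := by
    intro x hx y hy s
    have h1 := h (x + y) (add_mem hx hy) s
    have h2 := h (x + Complex.I • y) (add_mem hx (K.smul_mem _ hy)) s
    simp only [star_add, star_smul, add_mul, mul_add, map_add, h x hx s, h y hy s,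
      smul_mul_assoc, mul_smul_comm, map_smul, smul_zero, zero_add, add_zero] at h1 h2
    rw [eq_neg_of_add_eq_zero_left h1] at h2
    simp only [Complex.star_def, Complex.conj_I, smul_neg, neg_smul] at h2
    have h3 : (-(2 * Complex.I)) • δ s (x * m * star y) = 0 := by
      rw [← h2]; module
    exact (smul_eq_zero.1 h3).resolve_left (by simp)
  have hz : star m * m = 0 := hδ _ fun s => by
    simpa only [mul_assoc] using
      hpol (star m) (star_mem hm) (star m * m) (mul_mem (star_mem hm) hm) s
  exact CStarRing.star_mul_self_eq_zero_iff _ |>.1 hz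

variable [PartialOrder D] [StarOrderedRing D]

/-- Let `δ` be a faithful family of positive maps. An element `m` of a closed `*`-subalgebra `K` is
positive as soon as all `δ (x m x⋆)` are positive, for `x` in `K`. -/
lemma nonneg_of_forall_conj_nonneg (K : NonUnitalStarSubalgebra ℂ E) (hK : IsClosed (K : Set E))
    (δ : ι → E →ₗ[ℂ] D) (hδ : ∀ x, (∀ s, δ s (x * star x) = 0) → x = 0)
    (hpos : ∀ x, 0 ≤ x → ∀ s, 0 ≤ δ s x) (hstar : ∀ x s, δ s (star x) = star (δ s x))
    {m : E} (hm : m ∈ K) (h : ∀ x ∈ K, ∀ s, 0 ≤ δ s (x * m * star x)) : 0 ≤ m := by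
  have hsa : IsSelfAdjoint m := by
    refine sub_eq_zero.1 (eq_zero_of_forall_conj_eq_zero K δ hδ (sub_mem (star_mem hm) hm) ?_)
    intro x hx s
    have h1 : x * star m * star x = star (x * m * star x) := by
      simp only [star_mul, star_star, mul_assoc]
    rw [mul_sub, sub_mul, map_sub, h1, hstar, (h x hx s).isSelfAdjoint.star_eq, sub_self]
  rw [← CFC.negPart_eq_zero_iff m hsa]
  -- The negative part is a functional calculus of `m`, so it stays in the closed subalgebra.
  have hn : m⁻ ∈ K := by
    rw [CFC.negPart_def]
    exact cfcₙ_mem (𝕜' := ℂ) (hs := hK) _ hm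
  have hns : star m⁻ = m⁻ := (CFC.negPart_nonneg m).isSelfAdjoint.star_eq
  have hnm : m⁻ * m * m⁻ = -(m⁻ * m⁻ * star m⁻) := by
    nth_rw 2 [← CFC.posPart_sub_negPart m hsa]
    rw [mul_sub, CFC.negPart_mul_posPart, zero_sub, neg_mul, hns]
  -- Conjugating `m` by `x m⁻` produces `-x (m⁻)³ x⋆`, so `δ` of `x (m⁻)³ x⋆` is both positive and
  -- negative.
  have h3 : m⁻ * m⁻ * star m⁻ = 0 := by
    refine eq_zero_of_forall_conj_eq_zero K δ hδ (mul_mem (mul_mem hn hn) (star_mem hn)) ?_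
    intro x hx s
    refine le_antisymm ?_ (hpos _ ?_ s)
    · have h4 := h (x * m⁻) (mul_mem hx hn) s
      have h5 : x * m⁻ * m * star (x * m⁻) = x * (m⁻ * m * m⁻) * star x := by
        simp only [star_mul, hns, mul_assoc]
      rw [h5, hnm, mul_neg, neg_mul, map_neg] at h4
      exact neg_nonneg.1 h4
    · exact star_right_conjugate_nonneg
        (star_right_conjugate_nonneg (CFC.negPart_nonneg m) m⁻) x
  have h4 : star (star m⁻ * m⁻) * (star m⁻ * m⁻) = 0 := by
    rw [hns] at h3
    simp only [star_mul, hns]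
    rw [← mul_assoc, h3, zero_mul]
  exact CStarRing.star_mul_self_eq_zero_iff _ |>.1 (CStarRing.star_mul_self_eq_zero_iff _ |>.1 h4)

end FaithfulPositive

namespace CStarMatrix

variable {D ι : Type*} [NonUnitalCStarAlgebra D] [Fintype ι]

lemma mul_mul_star_apply (X M Y : CStarMatrix ι ι D) (s t : ι) :
    (X * M * star Y) s t = ∑ i, ∑ j, X s i * M i j * star (Y t j) := by
  rw [mul_apply, Finset.sum_comm]
  refine Finset.sum_congr rfl fun j _ => ?_
  rw [mul_apply, Finset.sum_mul]
  rfl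

/-- The diagonal entry `M s s` as a linear function of the matrix `M`. -/
def diagEntry (s : ι) : CStarMatrix ι ι D →ₗ[ℂ] D where
  toFun M := M s s
  map_add' _ _ := rfl
  map_smul' _ _ := rfl

variable [PartialOrder D] [StarOrderedRing D]

lemma diag_nonneg {M : CStarMatrix ι ι D} (hM : 0 ≤ M) (s : ι) : 0 ≤ M s s := by
  obtain ⟨N, rfl⟩ := exists_eq_star_mul_self_of_nonneg hM
  rw [mul_apply]
  exact Finset.sum_nonneg fun i _ => star_mul_self_nonneg (N i s)

lemma eq_zero_of_diag_mul_star_eq_zero {Z : CStarMatrix ι ι D}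
    (hZ : ∀ s, (Z * star Z) s s = 0) : Z = 0 := by
  ext s i
  have h : ∑ i, Z s i * star (Z s i) = 0 := by
    rw [← hZ s, mul_apply]
    rfl
  rw [Finset.sum_eq_zero_iff_of_nonneg fun i _ => mul_star_self_nonneg (Z s i)] at h
  exact CStarRing.mul_star_self_eq_zero_iff _ |>.1 (h i (Finset.mem_univ i))

/-- A matrix `M` in a closed `*`-subalgebra `K` of matrices is positive as soon as all the diagonal
entries of `X M X⋆` are positive, for `X` in `K`. -/
lemma nonneg_of_forall_diag_conj_nonneg (K : NonUnitalStarSubalgebra ℂ (CStarMatrix ι ι D))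
    (hK : IsClosed (K : Set (CStarMatrix ι ι D))) {M : CStarMatrix ι ι D} (hM : M ∈ K)
    (h : ∀ X ∈ K, ∀ s, 0 ≤ (X * M * star X) s s) : 0 ≤ M :=
  nonneg_of_forall_conj_nonneg K hK diagEntry (fun _ => eq_zero_of_diag_mul_star_eq_zero)
    (fun _ => diag_nonneg) (fun _ _ => rfl) hM h

lemma nonneg_iff_forall_sum_nonneg {M : CStarMatrix ι ι D} :
    0 ≤ M ↔ ∀ y : ι → D, 0 ≤ ∑ i, ∑ j, y i * M i j * star (y j) := by
  refine ⟨fun hM y => ?_, fun h => ?_⟩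
  · rcases isEmpty_or_nonempty ι with _ | ⟨⟨s⟩⟩
    · simp
    · have := diag_nonneg (star_right_conjugate_nonneg hM (ofMatrix fun _ j => y j)) s
      rwa [mul_mul_star_apply] at this
  · refine nonneg_of_forall_diag_conj_nonneg (D := D) (ι := ι) ⊤ isClosed_univ trivial
      fun X _ s => ?_
    rw [mul_mul_star_apply]
    exact h (X s)

end CStarMatrix

/-! ### The C*-seminorm defined by a positive map -/

section PositiveMap

variable {R D : Type*} [NonUnitalRing R] [StarRing R] [Module ℂ R] [IsScalarTower ℂ R R]
  [SMulCommClass ℂ R R] [StarModule ℂ R] [NonUnitalCStarAlgebra D] [PartialOrder D]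

/-- `C ≥ 0` bounds the left multiplication by `f` for the semi-inner product `Ψ (v⋆ w)`. -/
def IsLeftBound (Ψ : R →ₗ[ℂ] D) (f : R) (C : ℝ) : Prop :=
  0 ≤ C ∧ ∀ w, Ψ (star (f * w) * (f * w)) ≤ C ^ 2 • Ψ (star w * w)

variable {Ψ : R →ₗ[ℂ] D}

lemma real_smul_map (t : ℝ) (x : R) : t • Ψ x = Ψ ((t : ℂ) • x) := by
  rw [map_smul]
  exact (RCLike.real_smul_eq_coe_smul (K := ℂ) t (Ψ x))

variable [StarOrderedRing D]

/-- Positivity of `Ψ` on the square of `√t x - y / √t`. This weighted inequality in the order of `D`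
does the work of Cauchy-Schwarz below, each time with a suitable `t`. -/
lemma map_cross_le (hΨ : ∀ w, 0 ≤ Ψ (star w * w)) {t : ℝ} (ht : 0 < t) (x y : R) :
    Ψ (star x * y) + Ψ (star y * x) ≤ t • Ψ (star x * x) + t⁻¹ • Ψ (star y * y) := by
  have h := hΨ (((√t : ℝ) : ℂ) • x - (((√t)⁻¹ : ℝ) : ℂ) • y)
  have ht' : √t ≠ 0 := (Real.sqrt_pos.2 ht).ne'
  have h1 : star (((√t : ℝ) : ℂ) • x - (((√t)⁻¹ : ℝ) : ℂ) • y) *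
      (((√t : ℝ) : ℂ) • x - (((√t)⁻¹ : ℝ) : ℂ) • y) =
      (t : ℂ) • (star x * x) + ((t⁻¹ : ℝ) : ℂ) • (star y * y) - (star x * y + star y * x) := by
    simp only [star_sub, star_smul, sub_mul, mul_sub, smul_mul_assoc, mul_smul_comm, smul_sub, smul_smul,
      Complex.star_def, Complex.conj_ofReal, ← Complex.ofReal_mul]
    rw [Real.mul_self_sqrt ht.le, ← mul_inv, Real.mul_self_sqrt ht.le, mul_inv_cancel₀ ht',
      inv_mul_cancel₀ ht', Complex.ofReal_one, one_smul, one_smul]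
    abel
  rw [h1, map_sub, map_add, map_add, ← real_smul_map, ← real_smul_map] at h
  exact sub_nonneg.1 h

namespace IsLeftBound

lemma mono (hΨ : ∀ w, 0 ≤ Ψ (star w * w)) {f : R} {C C' : ℝ} (hf : IsLeftBound Ψ f C)
    (h : C ≤ C') : IsLeftBound Ψ f C' :=
  ⟨hf.1.trans h, fun w => (hf.2 w).trans
    (smul_le_smul_of_nonneg_right (pow_le_pow_left₀ hf.1 h 2) (hΨ w))⟩

/-- The weight `t = C' / C` makes the bounds add up to exactly `(C + C')²`; it is the reason for
strict positivity. -/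
lemma add (hΨ : ∀ w, 0 ≤ Ψ (star w * w)) {f g : R} {C C' : ℝ} (hf : IsLeftBound Ψ f C)
    (hg : IsLeftBound Ψ g C') (hC : 0 < C) (hC' : 0 < C') : IsLeftBound Ψ (f + g) (C + C') := by
  refine ⟨add_nonneg hf.1 hg.1, fun w => ?_⟩
  have h := map_cross_le hΨ (div_pos hC' hC) (f * w) (g * w)
  have h1 : star ((f + g) * w) * ((f + g) * w) = star (f * w) * (f * w) +
      (star (f * w) * (g * w) + star (g * w) * (f * w)) + star (g * w) * (g * w) := by
    simp only [add_mul, star_add, mul_add]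
    abel
  rw [h1, map_add, map_add, map_add]
  calc _ ≤ Ψ (star (f * w) * (f * w)) + ((C' / C) • Ψ (star (f * w) * (f * w)) +
        (C' / C)⁻¹ • Ψ (star (g * w) * (g * w))) + Ψ (star (g * w) * (g * w)) := by gcongr
    _ = (1 + C' / C) • Ψ (star (f * w) * (f * w)) +
        (1 + C / C') • Ψ (star (g * w) * (g * w)) := by
      rw [inv_div, add_smul, add_smul, one_smul, one_smul]
      abel
    _ ≤ (1 + C' / C) • (C ^ 2 • Ψ (star w * w)) + (1 + C / C') • (C' ^ 2 • Ψ (star w * w)) :=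
      add_le_add (smul_le_smul_of_nonneg_left (hf.2 w) (by positivity))
        (smul_le_smul_of_nonneg_left (hg.2 w) (by positivity))
    _ = (C + C') ^ 2 • Ψ (star w * w) := by
      rw [smul_smul, smul_smul, ← add_smul]
      congr 1
      field_simp
      ring

lemma mul {f g : R} {C C' : ℝ} (hf : IsLeftBound Ψ f C) (hg : IsLeftBound Ψ g C') :
    IsLeftBound Ψ (f * g) (C * C') := by
  refine ⟨mul_nonneg hf.1 hg.1, fun w => ?_⟩
  rw [mul_assoc, mul_pow, mul_smul]
  exact (hf.2 (g * w)).trans (smul_le_smul_of_nonneg_left (hg.2 w) (sq_nonneg C))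

lemma smul {f : R} {C : ℝ} (hf : IsLeftBound Ψ f C) (c : ℂ) :
    IsLeftBound Ψ (c • f) (‖c‖ * C) := by
  refine ⟨mul_nonneg (norm_nonneg c) hf.1, fun w => ?_⟩
  have h : star (c • f * w) * (c • f * w) = ((‖c‖ ^ 2 : ℝ) : ℂ) • (star (f * w) * (f * w)) := by
    simp only [smul_mul_assoc, star_smul, mul_smul_comm, smul_smul, Complex.star_def]
    rw [Complex.mul_conj', Complex.ofReal_pow]
  rw [h, ← real_smul_map, mul_pow, mul_smul]
  exact smul_le_smul_of_nonneg_left (hf.2 w) (sq_nonneg _)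

/-- For the vectors `w` and `f f⋆ w` both cross terms equal `Ψ ((f⋆ w)⋆ (f⋆ w))`. With weight `C²`,
the bound for `f` turns the last term into one more copy of it, which cancels. -/
lemma star_left (hΨ : ∀ w, 0 ≤ Ψ (star w * w)) {f : R} {C : ℝ} (hf : IsLeftBound Ψ f C)
    (hC : 0 < C) : IsLeftBound Ψ (star f) C := by
  refine ⟨hC.le, fun w => ?_⟩
  have h := map_cross_le hΨ (pow_pos hC 2) w (f * (star f * w))
  have h1 : star w * (f * (star f * w)) =
      star (star f * w) * (star f * w) := by
    simp only [star_mul, star_star, mul_assoc]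
  have h2 : star (f * (star f * w)) * w =
      star (star f * w) * (star f * w) := by
    simp only [star_mul, star_star, mul_assoc]
  rw [h1, h2] at h
  have h3 := smul_le_smul_of_nonneg_left (hf.2 (star f * w)) (inv_nonneg.2 (sq_nonneg C))
  rw [smul_smul, inv_mul_cancel₀ (pow_pos hC 2).ne', one_smul] at h3
  exact le_of_add_le_add_right (h.trans (add_le_add_right h3 _))

/-- The same device for `w` and `f⋆ f w`, with weight `C`. This is the hard half of the C*-identity.
-/
lemma sqrt_of_star_mul (hΨ : ∀ w, 0 ≤ Ψ (star w * w)) {f : R} {C : ℝ}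
    (hf : IsLeftBound Ψ (star f * f) C) (hC : 0 < C) : IsLeftBound Ψ f √C := by
  refine ⟨Real.sqrt_nonneg C, fun w => ?_⟩
  have h := map_cross_le hΨ hC w (star f * f * w)
  have h1 : star w * (star f * f * w) = star (f * w) * (f * w) := by
    simp only [star_mul, mul_assoc]
  have h2 : star (star f * f * w) * w = star (f * w) * (f * w) := by
    simp only [star_mul, star_star, mul_assoc]
  rw [h1, h2] at h
  have h3 := smul_le_smul_of_nonneg_left (hf.2 w) (inv_nonneg.2 hC.le)
  rw [smul_smul, show C⁻¹ * C ^ 2 = C by field_simp] at h3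
  have h4 := smul_le_smul_of_nonneg_left (h.trans (add_le_add_right h3 _))
    (show (0 : ℝ) ≤ 1 / 2 by norm_num)
  rw [Real.sq_sqrt hC.le]
  convert h4 using 1 <;> module

end IsLeftBound

lemma isLeftBound_csInf {f : R} (hf : ∃ C, IsLeftBound Ψ f C) :
    IsLeftBound Ψ f (sInf {C | IsLeftBound Ψ f C}) := by
  refine IsClosed.csInf_mem ?_ hf ⟨0, fun C hC => hC.1⟩
  have : {C | IsLeftBound Ψ f C} =
      {C : ℝ | 0 ≤ C} ∩ ⋂ w, {C : ℝ | Ψ (star (f * w) * (f * w)) ≤ C ^ 2 • Ψ (star w * w)} := by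
    ext C
    simp [IsLeftBound]
  have h : IsClosed {C | IsLeftBound Ψ f C} := by
    rw [this]
    exact (isClosed_le continuous_const continuous_id).inter
      (isClosed_iInter fun w => isClosed_le continuous_const (by fun_prop))
  exact h

lemma csInf_isLeftBound_le {f : R} {C : ℝ} (hf : IsLeftBound Ψ f C) :
    sInf {C | IsLeftBound Ψ f C} ≤ C :=
  csInf_le ⟨0, fun _ hC => hC.1⟩ hf

/-- The operator C*-seminorm of left multiplication, for the semi-inner product `Ψ (v⋆ w)`. -/
noncomputable def leftBoundSeminorm (hΨ : ∀ w, 0 ≤ Ψ (star w * w))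
    (hb : ∀ f, ∃ C, IsLeftBound Ψ f C) : CStarSeminorm R :=
  { Seminorm.ofSMulLE (𝕜 := ℂ) (fun f => sInf {C | IsLeftBound Ψ f C})
      (le_antisymm (csInf_isLeftBound_le ⟨le_rfl, fun w => by simp⟩)
        (isLeftBound_csInf (hb 0)).1)
      (fun f g => le_of_forall_pos_le_add fun ε hε => by
        have hf := isLeftBound_csInf (hb f)
        have hg := isLeftBound_csInf (hb g)
        have hε' := half_pos hε
        refine (csInf_isLeftBound_le (IsLeftBound.add hΨ
          (hf.mono hΨ (le_add_of_nonneg_right hε'.le))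
          (hg.mono hΨ (le_add_of_nonneg_right hε'.le))
          (add_pos_of_nonneg_of_pos hf.1 hε') (add_pos_of_nonneg_of_pos hg.1 hε'))).trans
          (le_of_eq (by ring)))
      (fun c f => csInf_isLeftBound_le ((isLeftBound_csInf (hb f)).smul c)) with
    mul_le' := fun f g =>
      csInf_isLeftBound_le ((isLeftBound_csInf (hb f)).mul (isLeftBound_csInf (hb g)))
    star_mul_self' := fun f => by
      change sInf {C | IsLeftBound Ψ (star f * f) C} = sInf {C | IsLeftBound Ψ f C} ^ 2
      have hf := isLeftBound_csInf (hb f)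
      have hff := isLeftBound_csInf (hb (star f * f))
      refine le_antisymm ?_ ?_
      · have h : ∀ ε : ℝ, 0 < ε → sInf {C | IsLeftBound Ψ (star f * f) C} ≤
            (sInf {C | IsLeftBound Ψ f C} + ε) ^ 2 := fun ε hε => by
          have h1 := hf.mono hΨ (le_add_of_nonneg_right hε.le)
          rw [sq]
          exact csInf_isLeftBound_le
            ((h1.star_left hΨ (add_pos_of_nonneg_of_pos hf.1 hε)).mul h1)
        have ht : Filter.Tendsto (fun ε : ℝ => (sInf {C | IsLeftBound Ψ f C} + ε) ^ 2)
            (nhdsWithin 0 (Set.Ioi 0)) (nhds (sInf {C | IsLeftBound Ψ f C} ^ 2)) := by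
          refine Filter.Tendsto.mono_left ?_ nhdsWithin_le_nhds
          exact Continuous.tendsto' (by fun_prop) _ _ (by simp)
        exact ge_of_tendsto ht (by filter_upwards [self_mem_nhdsWithin] with ε hε using h ε hε)
      · refine le_of_forall_pos_le_add fun ε hε => ?_
        have hpos := add_pos_of_nonneg_of_pos hff.1 hε
        have h1 := csInf_isLeftBound_le
          ((hff.mono hΨ (le_add_of_nonneg_right hε.le)).sqrt_of_star_mul hΨ hpos)
        calc _ ≤ √(sInf {C | IsLeftBound Ψ (star f * f) C} + ε) ^ 2 :=
              pow_le_pow_left₀ hf.1 h1 2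
          _ = _ := Real.sq_sqrt hpos.le }

lemma isLeftBound_leftBoundSeminorm (hΨ : ∀ w, 0 ≤ Ψ (star w * w))
    (hb : ∀ f, ∃ C, IsLeftBound Ψ f C) (f : R) :
    IsLeftBound Ψ f (leftBoundSeminorm hΨ hb f) :=
  isLeftBound_csInf (hb f)

end PositiveMap

/-! ### Completely positive forms on `*`-algebras -/

section CompletelyPositiveForm

variable {R D : Type*} [NonUnitalRing R] [StarRing R] [Module ℂ R] [NonUnitalCStarAlgebra D]
  [PartialOrder D]

/-- A linear map `Ψ` from a `*`-algebra to a C*-algebra such that all sums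
`∑_{i,j} y_i Ψ(w_i⋆ w_j) y_j⋆` are positive. -/
def IsCompletelyPositiveForm (Ψ : R →ₗ[ℂ] D) : Prop :=
  ∀ (n : ℕ) (w : Fin n → R) (y : Fin n → D),
    0 ≤ ∑ i, ∑ j, y i * Ψ (star (w i) * w j) * star (y j)

variable [StarOrderedRing D]

/-- `u x u → x` along an approximate unit, which replaces `y = 1` when `D` has no unit. -/
lemma nonneg_of_forall_conj_mul_star_nonneg {x : D} (hx : ∀ y, 0 ≤ y * x * star y) : 0 ≤ x := by
  have hl := CStarAlgebra.increasingApproximateUnit D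
  have : (CStarAlgebra.approximateUnit D).NeBot := hl.neBot
  have h1 : Tendsto (fun u : D => u * x * u) (CStarAlgebra.approximateUnit D) (𝓝 x) := by
    have h2 : Tendsto (fun u : D => u * (x * u - x) + u * x)
        (CStarAlgebra.approximateUnit D) (𝓝 (0 + x)) := by
      refine Tendsto.add ?_ (hl.tendsto_mul_right x)
      rw [tendsto_zero_iff_norm_tendsto_zero]
      have h3 : Tendsto (fun u : D => ‖x * u - x‖) (CStarAlgebra.approximateUnit D) (𝓝 0) :=
        tendsto_iff_norm_sub_tendsto_zero.1 (hl.tendsto_mul_left x)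
      refine squeeze_zero' (Eventually.of_forall fun _ => norm_nonneg _) ?_ h3
      filter_upwards [hl.eventually_norm] with u hu
      exact (norm_mul_le _ _).trans (mul_le_of_le_one_left (norm_nonneg _) hu)
    rw [zero_add] at h2
    refine h2.congr fun u => ?_
    rw [mul_sub, sub_add_cancel, mul_assoc]
  refine ge_of_tendsto h1 ?_
  filter_upwards [hl.eventually_star_eq] with u hu
  simpa only [hu] using hx u

namespace IsCompletelyPositiveForm

variable {Ψ : R →ₗ[ℂ] D}

lemma map_star_mul_self_nonneg (hΨ : IsCompletelyPositiveForm Ψ) (w : R) : 0 ≤ Ψ (star w * w) :=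
  nonneg_of_forall_conj_mul_star_nonneg fun y => by
    simpa using hΨ 1 (fun _ => w) (fun _ => y)

/-- The `2 × 2` matrix of the form on `v, w` is positive, hence selfadjoint. -/
lemma star_map_star_mul (hΨ : IsCompletelyPositiveForm Ψ) (v w : R) :
    star (Ψ (star v * w)) = Ψ (star w * v) := by
  let M : CStarMatrix (Fin 2) (Fin 2) D :=
    CStarMatrix.ofMatrix fun i j => Ψ (star (![v, w] i) * ![v, w] j)
  have hM : 0 ≤ M := CStarMatrix.nonneg_iff_forall_sum_nonneg.2 fun y => hΨ 2 ![v, w] y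
  have h := congrArg (fun N : CStarMatrix (Fin 2) (Fin 2) D => N 1 0) hM.isSelfAdjoint.star_eq
  exact h

/-- The Cauchy-Schwarz inequality. -/
lemma norm_map_star_mul_sq_le (hΨ : IsCompletelyPositiveForm Ψ) (v w : R) :
    ‖Ψ (star v * w)‖ ^ 2 ≤ ‖Ψ (star v * v)‖ * ‖Ψ (star w * w)‖ := by
  set a := Ψ (star v * w) with ha
  set P := Ψ (star v * v) with hP
  set Q := Ψ (star w * w) with hQ
  have hP0 : 0 ≤ P := hΨ.map_star_mul_self_nonneg v
  have hb : Ψ (star w * v) = star a := (hΨ.star_map_star_mul v w).symm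
  have h1 : ∀ s : ℝ, 0 ≤ star a * P * a - (2 * s) • (star a * a) + s ^ 2 • Q := fun s =>
    nonneg_of_forall_conj_mul_star_nonneg fun e => by
      -- The coefficients `-a⋆` and `s` complete the square; the factor `e` stands in for a unit of
      -- `D`.
      have h := hΨ 2 ![v, w] ![-(e * star a), s • e]
      simp only [Fin.sum_univ_two, Matrix.cons_val_zero, Matrix.cons_val_one, ← ha, ← hP, ← hQ,
        hb] at h
      convert h using 1
      simp only [star_neg, star_mul, star_star, star_smul, star_trivial, mul_add, add_mul, mul_sub,
        sub_mul, neg_mul, mul_neg, smul_mul_assoc, mul_smul_comm, mul_assoc]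
      module
  have h2 : ∀ ε : ℝ, 0 < ε → ‖a‖ ^ 2 ≤ (‖P‖ + ε) * ‖Q‖ := fun ε hε => by
    -- As `a⋆ P a ≤ ‖P‖ a⋆ a` and `2s - ‖P‖ ≥ s`, this choice gives `s a⋆ a ≤ s² Q`; `ε` allows
    -- division by `s`.
    set s := ‖P‖ + ε with hs
    have hs0 : 0 < s := add_pos_of_nonneg_of_pos (norm_nonneg P) hε
    have h3 : star a * P * a ≤ ‖P‖ • (star a * a) :=
      CStarAlgebra.star_left_conjugate_le_norm_smul hP0.isSelfAdjoint
    have h4 : s • (star a * a) ≤ s ^ 2 • Q := by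
      have h5 : (2 * s - ‖P‖) • (star a * a) ≤ s ^ 2 • Q := by
        have h6 := (h1 s).trans (add_le_add_left (sub_le_sub_right h3 _) _)
        rw [← sub_nonneg]
        convert h6 using 1
        module
      exact (smul_le_smul_of_nonneg_right (by linarith) (star_mul_self_nonneg a)).trans h5
    have h5 := CStarAlgebra.norm_le_norm_of_nonneg_of_le
      (smul_nonneg hs0.le (star_mul_self_nonneg a)) h4
    rw [norm_smul, norm_smul, CStarRing.norm_star_mul_self, Real.norm_of_nonneg hs0.le,
      Real.norm_of_nonneg (sq_nonneg s)] at h5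
    have h6 : s * ‖a‖ ^ 2 ≤ s * (s * ‖Q‖) := by
      convert h5 using 1 <;> ring
    exact le_of_mul_le_mul_left h6 hs0
  have ht : Tendsto (fun ε : ℝ => (‖P‖ + ε) * ‖Q‖) (𝓝[>] 0) (𝓝 (‖P‖ * ‖Q‖)) :=
    Tendsto.mono_left (Continuous.tendsto' (by fun_prop) _ _ (by simp)) nhdsWithin_le_nhds
  exact ge_of_tendsto ht (by filter_upwards [self_mem_nhdsWithin] with ε hε using h2 ε hε)

end IsCompletelyPositiveForm

end CompletelyPositiveForm

/-! ### The approximate unit of the unit fibre -/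

namespace PreFellBundle

universe u v

variable {G : Type u} [Group G] (𝒜 : PreFellBundle.{u, v} G)

/-- Identities between elements of fibres are checked in `C_c(𝒜)`, where the ring axioms hold
without transport between fibres. -/
lemma j_injective (g : G) : Function.Injective (𝒜.j g) := fun a b h => by
  rw [← 𝒜.j_apply_self g a, h, 𝒜.j_apply_self]

lemma norm_fmul_fstar_self {g : G} (a : 𝒜.fiber g) :
    ‖𝒜.fmul (mul_inv_cancel g) a (𝒜.fstar rfl a)‖ = ‖a‖ ^ 2 := by
  have h := 𝒜.norm_fstar_mul_self (inv_inv g) (mul_inv_cancel g) (𝒜.fstar rfl a)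
  rwa [𝒜.fstar_fstar, 𝒜.norm_fstar] at h

/-- With `r = a a⋆ ∈ A_e`, one has `‖u a - a‖² = ‖(u r - r) u - (u r - r)‖ ≤ 2 ‖u r - r‖`, so the
claim reduces to the C*-algebra `A_e`. -/
lemma tendsto_fmul_left {g : G} (a : 𝒜.fiber g) :
    Tendsto (fun u => 𝒜.fmul (one_mul g) u a) (CStarAlgebra.approximateUnit (𝒜.fiber 1))
      (𝓝 a) := by
  have hl := CStarAlgebra.increasingApproximateUnit (𝒜.fiber 1)
  let r : 𝒜.fiber 1 := 𝒜.fmul (mul_inv_cancel g) a (𝒜.fstar rfl a)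
  rw [tendsto_iff_norm_sub_tendsto_zero]
  have h1 : Tendsto (fun u => √(2 * ‖u * r - r‖)) (CStarAlgebra.approximateUnit (𝒜.fiber 1))
      (𝓝 0) := by
    have h2 := tendsto_iff_norm_sub_tendsto_zero.1 (hl.tendsto_mul_right r)
    have h3 := (Real.continuous_sqrt.tendsto _).comp (h2.const_mul 2)
    rwa [mul_zero, Real.sqrt_zero] at h3
  refine squeeze_zero' (Eventually.of_forall fun _ => norm_nonneg _) ?_ h1
  filter_upwards [hl.eventually_star_eq, hl.eventually_norm] with u hu hu1
  refine Real.le_sqrt_of_sq_le ?_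
  rw [← norm_fmul_fstar_self]
  have h2 : 𝒜.fmul (mul_inv_cancel g) (𝒜.fmul (one_mul g) u a - a)
      (𝒜.fstar rfl (𝒜.fmul (one_mul g) u a - a)) = (u * r - r) * u - (u * r - r) := by
    apply 𝒜.j_injective
    have hu' : star (𝒜.j 1 u) = 𝒜.j 1 u := by
      rw [𝒜.star_j inv_one]
      exact congrArg _ hu
    simp only [r, unitFiber_mul_def, map_sub, ← 𝒜.j_mul_j, ← 𝒜.star_j, star_sub, star_mul, hu']
    noncomm_ring
  rw [h2]
  calc _ ≤ ‖(u * r - r) * u‖ + ‖u * r - r‖ := norm_sub_le _ _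
    _ ≤ ‖u * r - r‖ * 1 + ‖u * r - r‖ := by
      gcongr
      exact (norm_mul_le _ _).trans (mul_le_mul_of_nonneg_left hu1 (norm_nonneg _))
    _ = 2 * ‖u * r - r‖ := by ring

lemma tendsto_fmul_right {g : G} (a : 𝒜.fiber g) :
    Tendsto (fun u => 𝒜.fmul (mul_one g) a u) (CStarAlgebra.approximateUnit (𝒜.fiber 1))
      (𝓝 a) := by
  have hl := CStarAlgebra.increasingApproximateUnit (𝒜.fiber 1)
  rw [tendsto_iff_norm_sub_tendsto_zero]
  refine (tendsto_iff_norm_sub_tendsto_zero.1 (𝒜.tendsto_fmul_left (𝒜.fstar rfl a))).congr' ?_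
  filter_upwards [hl.eventually_star_eq] with u hu
  rw [← 𝒜.norm_fstar rfl (𝒜.fmul (mul_one g) a u - a)]
  congr 1
  apply 𝒜.j_injective
  have hu' : star (𝒜.j 1 u) = 𝒜.j 1 u := by
    rw [𝒜.star_j inv_one]
    exact congrArg _ hu
  simp only [map_sub, ← 𝒜.j_mul_j, ← 𝒜.star_j, star_sub, star_mul, hu']

lemma tendsto_fmul_both {g : G} (a : 𝒜.fiber g) :
    Tendsto (fun u => 𝒜.fmul (mul_one g) (𝒜.fmul (one_mul g) u a) u)
      (CStarAlgebra.approximateUnit (𝒜.fiber 1)) (𝓝 a) := by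
  have hl := CStarAlgebra.increasingApproximateUnit (𝒜.fiber 1)
  have h1 := tendsto_iff_norm_sub_tendsto_zero.1 (𝒜.tendsto_fmul_left a)
  have h2 := tendsto_iff_norm_sub_tendsto_zero.1 (𝒜.tendsto_fmul_right a)
  rw [tendsto_iff_norm_sub_tendsto_zero]
  refine squeeze_zero' (Eventually.of_forall fun _ => norm_nonneg _) ?_ (by simpa using h1.add h2)
  filter_upwards [hl.eventually_norm] with u hu1
  have h3 : 𝒜.fmul (mul_one g) (𝒜.fmul (one_mul g) u a) u - a =
      𝒜.fmul (mul_one g) (𝒜.fmul (one_mul g) u a - a) u + (𝒜.fmul (mul_one g) a u - a) := by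
    apply 𝒜.j_injective
    simp only [map_sub, map_add, ← 𝒜.j_mul_j]
    noncomm_ring
  rw [h3]
  refine (norm_add_le _ _).trans (add_le_add_left ?_ _)
  exact (𝒜.norm_fmul_le _ _ _).trans (mul_le_of_le_one_right (norm_nonneg _) hu1)

end PreFellBundle

/-- An injective `*`-homomorphism is isometric, hence commutes with functional calculus and detects
the vanishing of the negative part. -/
lemma nonneg_of_map_nonneg_of_injective {A B : Type*} [NonUnitalCStarAlgebra A] [PartialOrder A]
    [StarOrderedRing A] [NonUnitalCStarAlgebra B] [PartialOrder B] [StarOrderedRing B]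
    (ψ : A →⋆ₙₐ[ℂ] B) (hψ : Function.Injective ψ) {a : A} (ha : 0 ≤ ψ a) : 0 ≤ a := by
  have hsa : IsSelfAdjoint a := hψ (by rw [map_star]; exact ha.isSelfAdjoint)
  rw [← CFC.negPart_eq_zero_iff a hsa]
  apply hψ
  rw [map_zero, CFC.negPart_def,
    NonUnitalStarAlgHom.map_cfcₙ ψ (·⁻ : ℝ → ℝ) a (by fun_prop) (by simp)
      (NonUnitalStarAlgHom.isometry ψ hψ).continuous hsa ha.isSelfAdjoint, ← CFC.negPart_def,
    CFC.negPart_eq_zero_iff (ψ a) ha.isSelfAdjoint]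
  exact ha

/-! ### Completely positive forms on sections are bounded -/

namespace FellBundle

universe u v

variable {G : Type u} [Group G] (𝒜 : FellBundle.{u, v} G)

section

variable {D : Type*} [NonUnitalCStarAlgebra D] [PartialOrder D] [StarOrderedRing D]
  {Ψ : 𝒜.Sections →ₗ[ℂ] D}

/-- The positivity axiom of the Fell bundle enters here: `‖a‖² - a⋆ a = (‖a‖ + s)²` with `s`
selfadjoint in `A_e`, so the difference of the two sides is `Ψ` of a square. -/
lemma isLeftBound_j (hΨ : ∀ w, 0 ≤ Ψ (star w * w)) (g : G) (a : 𝒜.fiber g) :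
    IsLeftBound Ψ (𝒜.j g a) ‖a‖ := by
  refine ⟨norm_nonneg a, fun w => ?_⟩
  obtain ⟨s, hs, hsr⟩ := exists_isSelfAdjoint_norm_sub_eq_sq (𝒜.starMulSelfNonneg g a)
  rw [𝒜.norm_fstar_mul_self, Real.sqrt_sq (norm_nonneg a)] at hsr
  have hs' : star (𝒜.j 1 s) = 𝒜.j 1 s := by
    rw [𝒜.star_j inv_one]
    exact congrArg _ hs.star_eq
  have hj := congrArg (𝒜.j 1) hsr
  rw [PreFellBundle.unitFiber_mul_def, map_add, RCLike.real_smul_eq_coe_smul (K := ℂ), map_smul,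
    map_neg, ← 𝒜.j_mul_j, ← 𝒜.j_mul_j, ← 𝒜.star_j] at hj
  have h1 := hΨ ((‖a‖ : ℂ) • w + 𝒜.j 1 s * w)
  have h2 : star ((‖a‖ : ℂ) • w + 𝒜.j 1 s * w) * ((‖a‖ : ℂ) • w + 𝒜.j 1 s * w) =
      ((‖a‖ ^ 2 : ℝ) : ℂ) • (star w * w) - star (𝒜.j g a * w) * (𝒜.j g a * w) := by
    have h3 : star w * (((2 * ‖a‖ : ℝ) : ℂ) • 𝒜.j 1 s + 𝒜.j 1 s * 𝒜.j 1 s) * w =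
        -(star (𝒜.j g a * w) * (𝒜.j g a * w)) := by
      refine (congrArg (fun x => star w * x * w) hj).trans ?_
      simp only [star_mul, mul_neg, neg_mul, mul_assoc]
    rw [sub_eq_add_neg, ← h3]
    simp only [star_add, star_mul, star_smul, hs', Complex.star_def, Complex.conj_ofReal, add_mul,
      mul_add, smul_mul_assoc, mul_smul_comm, smul_smul, mul_assoc, smul_add]
    push_cast
    module
  rw [h2, map_sub, ← real_smul_map] at h1
  exact sub_nonneg.1 h1

lemma exists_isLeftBound (hΨ : ∀ w, 0 ≤ Ψ (star w * w)) (f : 𝒜.Sections) :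
    ∃ C, IsLeftBound Ψ f C := by
  induction f using 𝒜.sections_induction with
  | h0 => exact ⟨0, le_rfl, fun w => by simp⟩
  | hj g a => exact ⟨‖a‖, 𝒜.isLeftBound_j hΨ g a⟩
  | hadd f f' hf hf' =>
    obtain ⟨C, hC⟩ := hf
    obtain ⟨C', hC'⟩ := hf'
    exact ⟨_, (hC.mono hΨ (lt_add_one C).le).add hΨ (hC'.mono hΨ (lt_add_one C').le)
      (add_pos_of_nonneg_of_pos hC.1 one_pos) (add_pos_of_nonneg_of_pos hC'.1 one_pos)⟩

/-- A completely positive form on `C_c(𝒜)` which is continuous on the fibres is bounded for the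
universal C*-norm, with the bound of its restriction to the unit fibre. -/
theorem norm_completelyPositiveForm_le (hΨ : IsCompletelyPositiveForm Ψ)
    (hc : ∀ g, Continuous fun a => Ψ (𝒜.j g a)) {K : ℝ} (hK0 : 0 ≤ K)
    (hK : ∀ a, ‖Ψ (𝒜.j 1 a)‖ ≤ K * ‖a‖) (f : 𝒜.Sections) :
    ‖Ψ f‖ ≤ K * 𝒜.universalNorm f := by
  have hl := CStarAlgebra.increasingApproximateUnit (𝒜.fiber 1)
  have : (CStarAlgebra.approximateUnit (𝒜.fiber 1)).NeBot := hl.neBot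
  have hpos := hΨ.map_star_mul_self_nonneg
  have hlim : Tendsto (fun u => Ψ (𝒜.j 1 u * f * 𝒜.j 1 u))
      (CStarAlgebra.approximateUnit (𝒜.fiber 1)) (𝓝 (Ψ f)) := by
    induction f using 𝒜.sections_induction with
    | h0 => simp
    | hadd f f' hf hf' => simpa only [mul_add, add_mul, map_add] using hf.add hf'
    | hj g a =>
      refine (((hc g).tendsto a).comp (𝒜.tendsto_fmul_both a)).congr fun u => ?_
      simp only [Function.comp_apply, ← 𝒜.j_mul_j]
  refine le_of_tendsto hlim.norm ?_
  filter_upwards [hl.eventually_star_eq, hl.eventually_norm] with u hu hu1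
  have hu' : star (𝒜.j 1 u) = 𝒜.j 1 u := by
    rw [𝒜.star_j inv_one]
    exact congrArg _ hu
  -- A C*-seminorm, hence dominated by the universal norm.
  let p := leftBoundSeminorm hpos (𝒜.exists_isLeftBound hpos)
  have hp : IsLeftBound Ψ f (p f) := isLeftBound_leftBoundSeminorm hpos _ f
  have h1 : ‖Ψ (star (𝒜.j 1 u) * 𝒜.j 1 u)‖ ≤ K := by
    rw [hu', 𝒜.j_mul_j (one_mul 1)]
    refine (hK _).trans (mul_le_of_le_one_right hK0 ((𝒜.norm_fmul_le _ _ _).trans ?_))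
    exact mul_le_one₀ hu1 (norm_nonneg u) hu1
  have h2 : ‖Ψ (star (f * 𝒜.j 1 u) * (f * 𝒜.j 1 u))‖ ≤ p f ^ 2 * K := by
    refine (CStarAlgebra.norm_le_norm_of_nonneg_of_le (hpos _) (hp.2 (𝒜.j 1 u))).trans ?_
    rw [norm_smul, Real.norm_of_nonneg (sq_nonneg _)]
    exact mul_le_mul_of_nonneg_left h1 (sq_nonneg _)
  -- The two factors are at most `K` and `p f ^ 2 * K`, so no constant is lost.
  have h3 := hΨ.norm_map_star_mul_sq_le (𝒜.j 1 u) (f * 𝒜.j 1 u)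
  have h4 : ‖Ψ (star (𝒜.j 1 u) * (f * 𝒜.j 1 u))‖ ^ 2 ≤ (K * p f) ^ 2 := by
    refine h3.trans ((mul_le_mul h1 h2 (norm_nonneg _) hK0).trans (le_of_eq (by ring)))
  rw [hu', ← mul_assoc] at h4
  exact (le_of_sq_le_sq h4 (mul_nonneg hK0 hp.1)).trans
    (mul_le_mul_of_nonneg_left (𝒜.seminorm_le_iSup p f) hK0)

end

/-! ### The conditional expectation and the norm of the fibres -/

/-- The conditional expectation `f ↦ f(e)` on `C_c(𝒜)`. -/
noncomputable def expectation : 𝒜.Sections →ₗ[ℂ] 𝒜.fiber 1 where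
  toFun f := f 1
  map_add' f f' := 𝒜.add_apply f f' 1
  map_smul' c f := DFinsupp.smul_apply c f 1

@[simp]
lemma expectation_j_one (a : 𝒜.fiber 1) : 𝒜.expectation (𝒜.j 1 a) = a := 𝒜.j_apply_self 1 a

lemma expectation_j_of_ne {g : G} (hg : g ≠ 1) (a : 𝒜.fiber g) : 𝒜.expectation (𝒜.j g a) = 0 :=
  𝒜.j_apply_of_ne hg.symm a

lemma mul_expectation (y : 𝒜.fiber 1) (f : 𝒜.Sections) :
    y * 𝒜.expectation f = 𝒜.expectation (𝒜.j 1 y * f) := by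
  induction f using 𝒜.sections_induction with
  | h0 => simp
  | hadd f f' hf hf' => simp only [map_add, mul_add, hf, hf']
  | hj g a =>
    rw [𝒜.j_mul_j (one_mul g)]
    by_cases hg : g = 1
    · subst hg
      rw [expectation_j_one, expectation_j_one]
      rfl
    · rw [𝒜.expectation_j_of_ne hg, 𝒜.expectation_j_of_ne hg, mul_zero]

lemma expectation_mul (f : 𝒜.Sections) (y : 𝒜.fiber 1) :
    𝒜.expectation f * y = 𝒜.expectation (f * 𝒜.j 1 y) := by
  induction f using 𝒜.sections_induction with
  | h0 => simp
  | hadd f f' hf hf' => simp only [map_add, add_mul, hf, hf']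
  | hj g a =>
    rw [𝒜.j_mul_j (mul_one g)]
    by_cases hg : g = 1
    · subst hg
      rw [expectation_j_one, expectation_j_one]
      rfl
    · rw [𝒜.expectation_j_of_ne hg, 𝒜.expectation_j_of_ne hg, zero_mul]

lemma star_mul_self_apply (f : 𝒜.Sections) :
    (star f * f) 1 = ∑ᶠ g, 𝒜.fmul (mul_inv_cancel g) (𝒜.fstar (inv_inv g) (f g⁻¹)) (f g⁻¹) := by
  rw [𝒜.mul_apply]
  refine finsum_congr fun g => ?_
  -- The convolution formula produces the index `g⁻¹ * 1`, which is equal to `g⁻¹` only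
  -- propositionally; a free index `k` allows substitution.
  have h : ∀ k (hk : k = g⁻¹) (e : g * k = 1), 𝒜.fmul e ((star f) g) (f k) =
      𝒜.fmul (mul_inv_cancel g) (𝒜.fstar (inv_inv g) (f g⁻¹)) (f g⁻¹) := by
    rintro _ rfl e
    rw [𝒜.star_apply]
  exact h _ (mul_one _) _

lemma expectation_star_mul_self_nonneg (f : 𝒜.Sections) : 0 ≤ 𝒜.expectation (star f * f) := by
  change 0 ≤ (star f * f) 1
  rw [star_mul_self_apply]
  refine finsum_nonneg fun g => ?_
  have h : ∀ k (e : k⁻¹ = g) (e' : g * k = 1) (a : 𝒜.fiber k),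
      0 ≤ 𝒜.fmul e' (𝒜.fstar e a) a := by
    rintro k rfl _ a
    exact 𝒜.starMulSelfNonneg k a
  exact h _ _ _ _

/-- The expectation is an `A_e`-bimodule map, so the sum is its value at `F⋆ F` with `F = ∑ w_i
y_i⋆`. -/
lemma isCompletelyPositiveForm_expectation : IsCompletelyPositiveForm 𝒜.expectation := by
  intro n w y
  have h := 𝒜.expectation_star_mul_self_nonneg (∑ i, w i * 𝒜.j 1 (star (y i)))
  have hy : ∀ i, star (𝒜.j 1 (star (y i))) = 𝒜.j 1 (y i) := fun i => by
    rw [PreFellBundle.unitFiber_star_def, ← 𝒜.star_j, star_star]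
  simp only [star_sum, Finset.sum_mul, Finset.mul_sum, map_sum, star_mul, hy] at h
  rw [Finset.sum_comm] at h
  refine h.trans (le_of_eq (Finset.sum_congr rfl fun i _ => Finset.sum_congr rfl fun j _ => ?_))
  rw [mul_expectation, expectation_mul]
  simp only [mul_assoc]

lemma norm_expectation_le (f : 𝒜.Sections) : ‖𝒜.expectation f‖ ≤ 𝒜.universalNorm f := by
  have h := 𝒜.norm_completelyPositiveForm_le 𝒜.isCompletelyPositiveForm_expectation (K := 1)
    (fun g => ?_) zero_le_one (fun a => by simp) f
  · rwa [one_mul] at h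
  · by_cases hg : g = 1
    · subst hg
      simp only [expectation_j_one]
      exact continuous_id
    · simp only [𝒜.expectation_j_of_ne hg]
      exact continuous_const

/-- `‖a‖² = ‖a⋆ a‖` is the norm of the expectation of `a⋆ a`, and the expectation is contractive for
the universal norm. -/
lemma universalNorm_j (g : G) (a : 𝒜.fiber g) : 𝒜.universalNorm (𝒜.j g a) = ‖a‖ := by
  refine le_antisymm (𝒜.seminorm_j_le _ g a) ?_
  have h := 𝒜.norm_expectation_le (star (𝒜.j g a) * 𝒜.j g a)
  rw [CStarSeminorm.star_mul_self, 𝒜.star_j rfl, 𝒜.j_mul_j (inv_mul_cancel g), expectation_j_one,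
    𝒜.norm_fstar_mul_self] at h
  exact le_of_sq_le_sq h (apply_nonneg _ _)

lemma norm_jHat (g : G) (a : 𝒜.fiber g) : ‖𝒜.jHat g a‖ = ‖a‖ := by
  rw [← 𝒜.universalNorm_j g a, ← CStarSeminorm.norm_toCompletion]
  rfl

lemma jHat_mul_jHat {g h k : G} (e : g * h = k) (a : 𝒜.fiber g) (b : 𝒜.fiber h) :
    𝒜.jHat g a * 𝒜.jHat h b = 𝒜.jHat k (𝒜.fmul e a b) := by
  have := 𝒜.universalNorm.toCompletion_mul (𝒜.j g a) (𝒜.j h b)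
  rw [𝒜.j_mul_j e] at this
  exact this.symm

lemma star_jHat {g k : G} (e : g⁻¹ = k) (a : 𝒜.fiber g) :
    star (𝒜.jHat g a) = 𝒜.jHat k (𝒜.fstar e a) := by
  have := 𝒜.universalNorm.toCompletion_star (𝒜.j g a)
  rw [𝒜.star_j e] at this
  exact this.symm

lemma jHat_one_nonneg_iff (a : 𝒜.fiber 1) : 0 ≤ 𝒜.jHat 1 a ↔ 0 ≤ a := by
  have hinj : Function.Injective (𝒜.unitFiberHom 𝒜.universalNorm) := by
    rw [injective_iff_map_eq_zero]
    intro a ha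
    rw [← norm_eq_zero, ← 𝒜.norm_jHat 1 a, norm_eq_zero]
    exact ha
  exact ⟨nonneg_of_map_nonneg_of_injective _ hinj,
    fun h => map_nonneg (𝒜.unitFiberHom 𝒜.universalNorm) h⟩

end FellBundle

namespace PreFellBundle

universe u v

variable {G : Type u} [Group G] (𝒜 : PreFellBundle.{u, v} G)

lemma isBoundedBilinearMap_fmul {g h k : G} (e : g * h = k) :
    IsBoundedBilinearMap ℂ fun p : 𝒜.fiber g × 𝒜.fiber h => 𝒜.fmul e p.1 p.2 where
  add_left := 𝒜.fadd_mul e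
  smul_left := 𝒜.fsmul_mul e
  add_right := 𝒜.fmul_add e
  smul_right := 𝒜.fmul_smul e
  bound := ⟨1, one_pos, fun a b => by simpa using 𝒜.norm_fmul_le e a b⟩

lemma continuous_fstar {g k : G} (e : g⁻¹ = k) : Continuous (𝒜.fstar e) :=
  (AddMonoidHomClass.isometry_of_norm (AddMonoidHom.mk' (𝒜.fstar e) (𝒜.fstar_add e))
    (𝒜.norm_fstar e)).continuous

end PreFellBundle

lemma FellBundle.fmul_fstar_self_nonneg {G : Type*} [Group G] (𝒜 : FellBundle G) {g : G}
    (a : 𝒜.fiber g) : 0 ≤ 𝒜.fmul (mul_inv_cancel g) a (𝒜.fstar rfl a) := by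
  have h : ∀ l k (e : k⁻¹ = l) (e' : l * k = 1) (a : 𝒜.fiber k),
      0 ≤ 𝒜.fmul e' (𝒜.fstar e a) a := by
    rintro _ k rfl _ a
    exact 𝒜.starMulSelfNonneg k a
  have h1 := h g g⁻¹ (inv_inv g) (mul_inv_cancel g) (𝒜.fstar rfl a)
  rwa [𝒜.fstar_fstar] at h1

namespace BundleMap

/-! ### The completely positive form of a positive definite bundle map -/

variable {G H : Type*} [Group G] [Group H] {𝒜 : FellBundle G} {φ : G →* H} {ℬ : FellBundle H}
  (T : BundleMap 𝒜 φ ℬ)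

/-- The linear map `κ ∘ φ_T : C_c(𝒜) → C*(ℬ)`. -/
noncomputable def form : 𝒜.Sections →ₗ[ℂ] ℬ.FullCStarAlgebra := ℬ.κ ∘ₗ T.sectionsMap

lemma form_j (g : G) (a : 𝒜.fiber g) : T.form (𝒜.j g a) = ℬ.jHat (φ g) (T.map g a) := by
  simp [form, sectionsMap, PreFellBundle.jHat]

lemma form_star_j_mul_j {g h : G} (a : 𝒜.fiber g) (b : 𝒜.fiber h) :
    T.form (star (𝒜.j g a) * 𝒜.j h b) =
      ℬ.jHat (φ (g⁻¹ * h)) (T.map (g⁻¹ * h) (𝒜.fmul rfl (𝒜.fstar rfl a) b)) := by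
  rw [𝒜.star_j rfl, 𝒜.j_mul_j rfl, form_j]

lemma continuous_form_j (g : G) : Continuous fun a => T.form (𝒜.j g a) := by
  simp only [form_j]
  exact (AddMonoidHomClass.isometry_of_norm (ℬ.jHat (φ g)) (ℬ.norm_jHat (φ g))).continuous.comp
    (T.map g).continuous

lemma norm_form_star_j_mul_j_le {g h : G} (a : 𝒜.fiber g) (b : 𝒜.fiber h) :
    ‖T.form (star (𝒜.j g a) * 𝒜.j h b)‖ ≤ ‖T.map (g⁻¹ * h)‖ * (‖a‖ * ‖b‖) := by
  rw [form_star_j_mul_j, ℬ.norm_jHat]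
  refine ((T.map _).le_opNorm _).trans (mul_le_mul_of_nonneg_left ?_ (norm_nonneg _))
  exact (𝒜.norm_fmul_le _ _ _).trans_eq (by rw [𝒜.norm_fstar])

lemma continuous_form_star_j_mul_j (g h : G) :
    Continuous fun p : 𝒜.fiber g × 𝒜.fiber h => T.form (star (𝒜.j g p.1) * 𝒜.j h p.2) := by
  have h1 : Continuous fun p : 𝒜.fiber g × 𝒜.fiber h =>
      𝒜.fmul (rfl : g⁻¹ * h = g⁻¹ * h) (𝒜.fstar rfl p.1) p.2 :=
    (𝒜.isBoundedBilinearMap_fmul rfl).continuous.comp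
      (((𝒜.continuous_fstar rfl).comp continuous_fst).prodMk continuous_snd)
  refine ((T.continuous_form_j (g⁻¹ * h)).comp h1).congr fun p => ?_
  simp only [Function.comp_apply, ← 𝒜.j_mul_j, ← 𝒜.star_j]

lemma isPositiveDefinite_iff : T.IsPositiveDefinite ↔
    ∀ (n : ℕ) (g : Fin n → G) (a : ∀ i, 𝒜.fiber (g i)) (b : ∀ i, ℬ.fiber (φ (g i))),
      0 ≤ ∑ i, ∑ j, ℬ.jHat _ (b i) * T.form (star (𝒜.j _ (a i)) * 𝒜.j _ (a j)) *
        star (ℬ.jHat _ (b j)) := by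
  refine forall₄_congr fun n g a b => ?_
  rw [← ℬ.jHat_one_nonneg_iff]
  refine Eq.to_iff (congrArg _ ?_)
  simp only [map_sum, form_star_j_mul_j, ← ℬ.jHat_mul_jHat, ← ℬ.star_jHat]

variable {T}

lemma IsPositiveDefinite.sum_nonneg (hT : T.IsPositiveDefinite) {ι : Type*} [Fintype ι]
    (g : ι → G) (a : ∀ i, 𝒜.fiber (g i)) (b : ∀ i, ℬ.fiber (φ (g i))) :
    0 ≤ ∑ i, ∑ j, ℬ.jHat _ (b i) * T.form (star (𝒜.j _ (a i)) * 𝒜.j _ (a j)) *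
        star (ℬ.jHat _ (b j)) := by
  let e := (Fintype.equivFin ι).symm
  refine (T.isPositiveDefinite_iff.1 hT _ (g ∘ e) (fun i => a (e i)) (fun i => b (e i))).trans_eq ?_
  rw [← e.sum_comp]
  refine Finset.sum_congr rfl fun i _ => ?_
  exact e.sum_comp fun j => ℬ.jHat _ (b (e i)) * T.form (star (𝒜.j _ (a (e i))) * 𝒜.j _ (a j)) *
        star (ℬ.jHat _ (b j))

/-! ### Testing the matrix of `T` on homogeneous rows. -/

variable {ι : Type*} [Fintype ι] (T) (g : ι → G) (a : ∀ i, 𝒜.fiber (g i))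

/-- The matrix of all `T(a_i⋆ a_j)` is positive over `C*(ℬ)`. -/
def HasPositiveMatrix : Prop :=
  ∀ y : ι → ℬ.FullCStarAlgebra,
    0 ≤ ∑ i, ∑ j, y i * T.form (star (𝒜.j _ (a i)) * 𝒜.j _ (a j)) * star (y j)

/-- The matrix of all `T((x a_i)⋆ (x a_j))`, with `x` in the unit fibre, is positive on the rows
with entries in `B_{φ(k⁻¹ g_i)}`. -/
def IsPositiveOnRow (k : G) : Prop :=
  ∀ (x : 𝒜.fiber 1) (b : ∀ i, ℬ.fiber (φ (k⁻¹ * g i))),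
    0 ≤ ∑ i, ∑ j, ℬ.jHat _ (b i) *
      T.form (star (𝒜.j 1 x * 𝒜.j _ (a i)) * (𝒜.j 1 x * 𝒜.j _ (a j))) * star (ℬ.jHat _ (b j))

variable {T g a}

/-- The factor `x` is removed by letting it run through an approximate unit of `A_e`. -/
lemma IsPositiveOnRow.sum_nonneg {k : G} (h : T.IsPositiveOnRow g a k)
    (b : ∀ i, ℬ.fiber (φ (k⁻¹ * g i))) :
    0 ≤ ∑ i, ∑ j, ℬ.jHat _ (b i) * T.form (star (𝒜.j _ (a i)) * 𝒜.j _ (a j)) *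
      star (ℬ.jHat _ (b j)) := by
  have hl := CStarAlgebra.increasingApproximateUnit (𝒜.fiber 1)
  have : (CStarAlgebra.approximateUnit (𝒜.fiber 1)).NeBot := hl.neBot
  refine ge_of_tendsto (x := CStarAlgebra.approximateUnit (𝒜.fiber 1)) ?_
    (Eventually.of_forall fun x => h x b)
  refine tendsto_finsetSum _ fun i _ => tendsto_finsetSum _ fun j _ => ?_
  refine Tendsto.mul_const _ (Tendsto.const_mul _ ?_)
  refine (((T.continuous_form_star_j_mul_j (g i) (g j)).tendsto (a i, a j)).comp
    ((𝒜.tendsto_fmul_left (a i)).prodMk_nhds (𝒜.tendsto_fmul_left (a j)))).congr fun x => ?_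
  simp only [Function.comp_apply, ← 𝒜.j_mul_j]

/-- The factor `x` absorbs left multiplication by `A_e`; this is why row positivity survives later
splittings. -/
lemma IsPositiveOnRow.of_left_mul {k : G} (h : T.IsPositiveOnRow g a k) {a' : ∀ i, 𝒜.fiber (g i)}
    (ha' : ∀ x : 𝒜.fiber 1, ∃ x' : 𝒜.fiber 1, ∀ i,
      𝒜.j 1 x * 𝒜.j _ (a' i) = 𝒜.j 1 x' * 𝒜.j _ (a i)) : T.IsPositiveOnRow g a' k := by
  intro x b
  obtain ⟨x', hx'⟩ := ha' x
  simp only [hx']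
  exact h x' b

/-- Replacing `a_s` by `0` has the same effect as replacing `b_s` by `0`. -/
lemma IsPositiveOnRow.update_zero [DecidableEq ι] {k : G} (h : T.IsPositiveOnRow g a k) (s : ι) :
    T.IsPositiveOnRow g (Function.update a s 0) k := by
  intro x b
  refine (h x (Function.update b s 0)).trans_eq ?_
  refine Finset.sum_congr rfl fun i _ => Finset.sum_congr rfl fun j _ => ?_
  rcases eq_or_ne i s with rfl | hi
  · simp
  rcases eq_or_ne j s with rfl | hj
  · simp
  simp [hi, hj]

/-- Writing `c⋆ x⋆ x c = y⋆ y` with `y ∈ A_e` gives `(x p a_i)⋆ (x p a_j) = d_i⋆ d_j` for `d_i = y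
c⋆ m a_i`. These lie in `A_{k⁻¹g_i}`, the fibres matching the `b_i`, so positive definiteness
applies. -/
lemma IsPositiveDefinite.isPositiveOnRow (hT : T.IsPositiveDefinite) {k : G} (c : 𝒜.fiber k)
    {p m : 𝒜.fiber 1} (hp : p = 𝒜.fmul (mul_inv_cancel k) c (𝒜.fstar rfl c) * m)
    {a' : ∀ i, 𝒜.fiber (g i)} (ha' : ∀ i, a' i = 𝒜.fmul (one_mul _) p (a i)) :
    T.IsPositiveOnRow g a' k := by
  intro x b
  obtain ⟨y, hy⟩ := CStarAlgebra.nonneg_iff_eq_star_mul_self.1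
    (𝒜.starMulSelfNonneg k (𝒜.fmul (one_mul k) x c))
  have hy' := congrArg (𝒜.j 1) hy
  simp only [PreFellBundle.unitFiber_mul_def, PreFellBundle.unitFiber_star_def, ← 𝒜.j_mul_j,
    ← 𝒜.star_j, star_mul] at hy'
  have hyz : ∀ z, star (𝒜.j 1 y) * (𝒜.j 1 y * z) =
      star (𝒜.j k c) * (star (𝒜.j 1 x) * (𝒜.j 1 x * (𝒜.j k c * z))) := fun z => by
    simpa only [mul_assoc] using (congrArg (· * z) hy').symm
  let d : ∀ i, 𝒜.fiber (k⁻¹ * g i) := fun i =>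
    𝒜.fmul rfl (𝒜.fmul (one_mul _) y (𝒜.fmul (mul_one _) (𝒜.fstar rfl c) m)) (a i)
  refine (hT.sum_nonneg (fun i => k⁻¹ * g i) d b).trans_eq ?_
  refine Finset.sum_congr rfl fun i _ => Finset.sum_congr rfl fun j _ => ?_
  congr 3
  simp only [d, ha', hp, PreFellBundle.unitFiber_mul_def, ← 𝒜.j_mul_j, ← 𝒜.star_j, star_mul,
    star_star, mul_assoc, hyz]

end BundleMap

/-! ### Matrices with homogeneous entries. -/

namespace FellBundle

variable {H : Type*} [Group H] (ℬ : FellBundle H)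

lemma isClosed_range_jHat (h : H) :
    IsClosed (LinearMap.range (ℬ.jHat h) : Set ℬ.FullCStarAlgebra) := by
  rw [LinearMap.coe_range]
  exact (AddMonoidHomClass.isometry_of_norm (ℬ.jHat h)
    (ℬ.norm_jHat h)).isClosedEmbedding.isClosed_range

/-- The matrices `X` over `C*(ℬ)` with entries `X i j` in `B_{h_i⁻¹ h_j}`, which vanish on the rows
and columns in `Z`. -/
def homogeneousMatrices {ι : Type*} [Fintype ι] (h : ι → H) (Z : Set ι) :
    NonUnitalStarSubalgebra ℂ (CStarMatrix ι ι ℬ.FullCStarAlgebra) where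
  carrier := {X | ∀ i j, X i j ∈ LinearMap.range (ℬ.jHat ((h i)⁻¹ * h j)) ∧
    (i ∈ Z ∨ j ∈ Z → X i j = 0)}
  add_mem' hX hY i j := ⟨add_mem (hX i j).1 (hY i j).1, fun hij => by
    rw [CStarMatrix.add_apply, (hX i j).2 hij, (hY i j).2 hij, add_zero]⟩
  zero_mem' i j := ⟨zero_mem _, fun _ => rfl⟩
  smul_mem' c X hX i j := ⟨Submodule.smul_mem _ c (hX i j).1, fun hij => by
    rw [CStarMatrix.smul_apply, (hX i j).2 hij, smul_zero]⟩
  mul_mem' {X Y} hX hY i j := by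
    rw [CStarMatrix.mul_apply]
    refine ⟨sum_mem fun k _ => ?_, fun hij => Finset.sum_eq_zero fun k _ => ?_⟩
    · obtain ⟨a, ha⟩ := (hX i k).1
      obtain ⟨b, hb⟩ := (hY k j).1
      rw [← ha, ← hb, ℬ.jHat_mul_jHat (show (h i)⁻¹ * h k * ((h k)⁻¹ * h j) = (h i)⁻¹ * h j by group)]
      exact ⟨_, rfl⟩
    · rcases hij with hi | hj
      · rw [(hX i k).2 (.inl hi), zero_mul]
      · rw [(hY k j).2 (.inr hj), mul_zero]
  star_mem' {X} hX i j := by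
    rw [CStarMatrix.star_apply]
    refine ⟨?_, fun hij => by rw [(hX j i).2 hij.symm, star_zero]⟩
    obtain ⟨a, ha⟩ := (hX j i).1
    rw [← ha, ℬ.star_jHat (show ((h j)⁻¹ * h i)⁻¹ = (h i)⁻¹ * h j by group)]
    exact ⟨_, rfl⟩

lemma isClosed_homogeneousMatrices {ι : Type*} [Fintype ι] (h : ι → H) (Z : Set ι) :
    IsClosed (ℬ.homogeneousMatrices h Z : Set (CStarMatrix ι ι ℬ.FullCStarAlgebra)) := by
  have hc : ∀ i j, Continuous fun X : CStarMatrix ι ι ℬ.FullCStarAlgebra => X i j := fun i j =>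
    (continuous_apply j).comp (continuous_apply (A := fun _ => ι → ℬ.FullCStarAlgebra) i)
  have : (ℬ.homogeneousMatrices h Z : Set (CStarMatrix ι ι ℬ.FullCStarAlgebra)) =
      ⋂ i, ⋂ j, {X | X i j ∈ (LinearMap.range (ℬ.jHat ((h i)⁻¹ * h j)) : Set ℬ.FullCStarAlgebra)} ∩
        ⋂ (_ : i ∈ Z ∨ j ∈ Z), {X | X i j = 0} := by
    ext X
    simp only [Set.mem_iInter, Set.mem_inter_iff]
    rfl
  rw [this]
  exact isClosed_iInter fun i => isClosed_iInter fun j =>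
    ((ℬ.isClosed_range_jHat _).preimage (hc i j)).inter
      (isClosed_iInter fun _ => isClosed_eq (hc i j) continuous_const)

end FellBundle

/-! ### Positivity of the matrix of `T`, by splitting along the `a_s`. -/

namespace BundleMap

variable {G H : Type*} [Group G] [Group H] {𝒜 : FellBundle G} {φ : G →* H} {ℬ : FellBundle H}
  {T : BundleMap 𝒜 φ ℬ} {ι : Type*} [Fintype ι] {g : ι → G} {a : ∀ i, 𝒜.fiber (g i)}

/-- The matrix lies in `homogeneousMatrices`, so only the rows of elements of that algebra need
testing. Rows indexed by `Z` vanish; row `s ∉ Z` has entries in `B_{φ(g_s⁻¹g_i)}`. -/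
lemma hasPositiveMatrix_of_isPositiveOnRow (Z : Set ι) (hZ : ∀ s ∈ Z, a s = 0)
    (ha : ∀ s ∉ Z, T.IsPositiveOnRow g a (g s)) : T.HasPositiveMatrix g a := by
  let M : CStarMatrix ι ι ℬ.FullCStarAlgebra :=
    CStarMatrix.ofMatrix fun i j => T.form (star (𝒜.j _ (a i)) * 𝒜.j _ (a j))
  suffices hM : 0 ≤ M from CStarMatrix.nonneg_iff_forall_sum_nonneg.1 hM
  have hφ : ∀ i j, φ ((g i)⁻¹ * g j) = (φ (g i))⁻¹ * φ (g j) := fun i j => by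
    rw [map_mul, map_inv]
  refine CStarMatrix.nonneg_of_forall_diag_conj_nonneg
    (ℬ.homogeneousMatrices (fun i => φ (g i)) Z) (ℬ.isClosed_homogeneousMatrices _ _) ?_ ?_
  · intro i j
    refine ⟨?_, ?_⟩
    · rw [← hφ i j]
      exact ⟨_, (T.form_star_j_mul_j (a i) (a j)).symm⟩
    · rintro (hi | hj)
      · change T.form (star (𝒜.j _ (a i)) * 𝒜.j _ (a j)) = 0
        rw [hZ i hi]
        simp
      · change T.form (star (𝒜.j _ (a i)) * 𝒜.j _ (a j)) = 0
        rw [hZ j hj]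
        simp
  · intro X hX s
    rw [CStarMatrix.mul_mul_star_apply]
    by_cases hs : s ∈ Z
    · simp [(hX s _).2 (.inl hs)]
    · have hb : ∀ i, ∃ b : ℬ.fiber (φ ((g s)⁻¹ * g i)), ℬ.jHat _ b = X s i := fun i => by
        rw [hφ s i]
        exact (hX s i).1
      choose b hb using hb
      have := (ha s hs).sum_nonneg b
      simp only [hb] at this
      exact this

/-- Splitting a family `a_i` along the left support of `a_s`. -/
lemma exists_split (s : ι) {ε : ℝ} (hε : 0 < ε) :
    ∃ (p m v : 𝒜.fiber 1) (a' a'' : ∀ i, 𝒜.fiber (g i)),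
      p = 𝒜.fmul (mul_inv_cancel (g s)) (a s) (𝒜.fstar rfl (a s)) * m ∧
      (∀ i, a' i = 𝒜.fmul (one_mul _) p (a i)) ∧
      (∀ i, a'' i = a i - 𝒜.fmul (one_mul _) v (a i)) ∧
      (∀ i j, star (𝒜.j _ (a i)) * 𝒜.j _ (a j) =
        star (𝒜.j _ (a' i)) * 𝒜.j _ (a' j) + star (𝒜.j _ (a'' i)) * 𝒜.j _ (a'' j)) ∧
      (∀ i, ‖a'' i‖ ≤ ‖a i‖) ∧ ‖a'' s‖ ^ 2 ≤ ε := by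
  obtain ⟨p, m, v, hp, hv, hpm, hpv, hb⟩ :=
    exists_approximate_support (𝒜.fmul_fstar_self_nonneg (a s)) hε
  have hp' : star (𝒜.j 1 p) = 𝒜.j 1 p := by
    rw [𝒜.star_j inv_one]
    exact congrArg _ hp.star_eq
  have hv' : star (𝒜.j 1 v) = 𝒜.j 1 v := by
    rw [𝒜.star_j inv_one]
    exact congrArg _ hv.star_eq
  have hpv' : ∀ z, 𝒜.j 1 p * (𝒜.j 1 p * z) = 𝒜.j 1 v * z + 𝒜.j 1 v * z -
      𝒜.j 1 v * (𝒜.j 1 v * z) := fun z => by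
    have h := congrArg (fun x => 𝒜.j 1 x * z) hpv
    simp only [PreFellBundle.unitFiber_mul_def, map_add, ← 𝒜.j_mul_j, add_mul, mul_assoc] at h
    rw [← h, add_sub_cancel_right]
  have hsum : ∀ i j, star (𝒜.j _ (a i)) * 𝒜.j _ (a j) =
      star (𝒜.j _ (𝒜.fmul (one_mul _) p (a i))) * 𝒜.j _ (𝒜.fmul (one_mul _) p (a j)) +
      star (𝒜.j _ (a i - 𝒜.fmul (one_mul _) v (a i))) *
        𝒜.j _ (a j - 𝒜.fmul (one_mul _) v (a j)) := fun i j => by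
    simp only [map_sub, ← 𝒜.j_mul_j, star_mul, star_sub, hp', hv', mul_assoc, sub_mul, mul_sub,
      hpv', mul_add]
    abel
  refine ⟨p, m, v, fun i => 𝒜.fmul (one_mul _) p (a i),
    fun i => a i - 𝒜.fmul (one_mul _) v (a i), hpm, fun _ => rfl, fun _ => rfl, hsum,
    fun i => ?_, ?_⟩
  -- The diagonal case reads `a_i⋆ a_i = a'_i⋆ a'_i + a''_i⋆ a''_i`, a sum of positive elements.
  · have h := hsum i i
    simp only [𝒜.star_j rfl] at h
    rw [𝒜.j_mul_j (inv_mul_cancel (g i)), 𝒜.j_mul_j (inv_mul_cancel (g i)),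
      𝒜.j_mul_j (inv_mul_cancel (g i)), ← map_add] at h
    have h1 := 𝒜.j_injective 1 h
    have h2 := CStarAlgebra.norm_le_norm_of_nonneg_of_le
      (𝒜.starMulSelfNonneg (g i) (a i - 𝒜.fmul (one_mul _) v (a i)))
      ((le_add_of_nonneg_left (𝒜.starMulSelfNonneg (g i) _)).trans_eq h1.symm)
    rw [𝒜.norm_fstar_mul_self, 𝒜.norm_fstar_mul_self] at h2
    exact le_of_sq_le_sq h2 (norm_nonneg _)
  -- `a''_s a''_s⋆ = (1 - v) r (1 - v)` for `r = a_s a_s⋆`.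
  · rw [← 𝒜.norm_fmul_fstar_self]
    refine le_trans (le_of_eq (congrArg _ ?_)) hb
    apply 𝒜.j_injective
    simp only [PreFellBundle.unitFiber_mul_def, map_sub, map_add, ← 𝒜.j_mul_j, ← 𝒜.star_j,
      star_sub, star_mul, hv', mul_sub, sub_mul, mul_assoc]
    abel

/-- The matrix of a family is positive if this holds for small perturbations of a splitting. -/
lemma hasPositiveMatrix_of_split [DecidableEq ι] (s : ι)
    (h : ∀ (p m v : 𝒜.fiber 1) (a' a'' : ∀ i, 𝒜.fiber (g i)),
      p = 𝒜.fmul (mul_inv_cancel (g s)) (a s) (𝒜.fstar rfl (a s)) * m →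
      (∀ i, a' i = 𝒜.fmul (one_mul _) p (a i)) →
      (∀ i, a'' i = a i - 𝒜.fmul (one_mul _) v (a i)) →
      T.HasPositiveMatrix g a' ∧ T.HasPositiveMatrix g (Function.update a'' s 0)) :
    T.HasPositiveMatrix g a := by
  intro y
  have hε : ∀ n : ℕ, (0 : ℝ) < 1 / ((n : ℝ) + 1) := fun n => by positivity
  choose p m v a' a'' hp ha' ha'' hsum hle hs using fun n => exists_split (a := a) s (hε n)
  have hs0 : Tendsto (fun n => ‖a'' n s‖) atTop (𝓝 0) := by
    have h1 : Tendsto (fun n => ‖a'' n s‖ ^ 2) atTop (𝓝 0) :=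
      squeeze_zero (fun n => sq_nonneg _) hs tendsto_one_div_add_atTop_nhds_zero_nat
    have h2 := (Real.continuous_sqrt.tendsto 0).comp h1
    rw [Real.sqrt_zero] at h2
    exact h2.congr fun n => Real.sqrt_sq (norm_nonneg _)
  -- Zeroing `a''_s` only changes entries involving the index `s`, which tend to `0` since the other
  -- factor stays bounded by `‖a_i‖`.
  have hd : ∀ i j, Tendsto (fun n => T.form (star (𝒜.j _ (Function.update (a'' n) s 0 i)) *
      𝒜.j _ (Function.update (a'' n) s 0 j)) - T.form (star (𝒜.j _ (a'' n i)) * 𝒜.j _ (a'' n j)))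
      atTop (𝓝 0) := by
    intro i j
    by_cases hij : i = s ∨ j = s
    · have h0 : ∀ n, T.form (star (𝒜.j _ (Function.update (a'' n) s 0 i)) *
          𝒜.j _ (Function.update (a'' n) s 0 j)) = 0 := fun n => by
        rcases hij with rfl | rfl <;> simp
      simp only [h0, zero_sub]
      rw [← neg_zero]
      refine Tendsto.neg (squeeze_zero_norm (fun n => T.norm_form_star_j_mul_j_le _ _) ?_)
      rw [← mul_zero ‖T.map ((g i)⁻¹ * g j)‖]
      refine Tendsto.const_mul _ ?_
      rcases hij with rfl | rfl
      · refine squeeze_zero (fun n => by positivity)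
          (fun n => mul_le_mul_of_nonneg_left (hle n j) (norm_nonneg _)) ?_
        simpa using hs0.mul_const ‖a j‖
      · refine squeeze_zero (fun n => by positivity)
          (fun n => mul_le_mul_of_nonneg_right (hle n i) (norm_nonneg _)) ?_
        simpa using hs0.const_mul ‖a i‖
    · rw [not_or] at hij
      simp [hij.1, hij.2]
  have hlim : Tendsto (fun n => ∑ i, ∑ j, y i * (T.form (star (𝒜.j _ (a' n i)) * 𝒜.j _ (a' n j)) +
      T.form (star (𝒜.j _ (Function.update (a'' n) s 0 i)) *
        𝒜.j _ (Function.update (a'' n) s 0 j))) * star (y j)) atTop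
      (𝓝 (∑ i, ∑ j, y i * T.form (star (𝒜.j _ (a i)) * 𝒜.j _ (a j)) * star (y j))) := by
    refine tendsto_finsetSum _ fun i _ => tendsto_finsetSum _ fun j _ => ?_
    refine Tendsto.mul_const _ (Tendsto.const_mul _ ?_)
    have h1 := (hd i j).add_const (T.form (star (𝒜.j _ (a i)) * 𝒜.j _ (a j)))
    rw [zero_add] at h1
    refine h1.congr fun n => ?_
    rw [hsum n i j, map_add]
    abel
  refine ge_of_tendsto hlim (Eventually.of_forall fun n => ?_)
  obtain ⟨h1, h2⟩ := h _ _ _ _ _ (hp n) (ha' n) (ha'' n)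
  refine (add_nonneg (h1 y) (h2 y)).trans_eq ?_
  simp only [mul_add, add_mul, Finset.sum_add_distrib]

/-- Induction on the set `U` of untreated indices; rows in `P` are already positive and `a` vanishes
on `Z`. Splitting along `a_s` puts `s` into `P` for the first piece and into `Z` for the second.
Both pieces are left multiples of `a`, up to zeroing `a_s`, so `P` and `Z` keep their properties. -/
lemma IsPositiveDefinite.hasPositiveMatrix_aux [DecidableEq ι] (hT : T.IsPositiveDefinite)
    (U : Finset ι) : ∀ (P Z : Set ι) (a : ∀ i, 𝒜.fiber (g i)), (∀ i, i ∈ P ∨ i ∈ Z ∨ i ∈ U) →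
      (∀ s ∈ Z, a s = 0) → (∀ s ∈ P, T.IsPositiveOnRow g a (g s)) → T.HasPositiveMatrix g a := by
  induction U using Finset.induction_on with
  | empty =>
    intro P Z a hU hZ hP
    refine hasPositiveMatrix_of_isPositiveOnRow Z hZ fun s hs => hP s ?_
    simpa [hs] using hU s
  | insert s U _ ih =>
    intro P Z a hU hZ hP
    refine hasPositiveMatrix_of_split s fun p m v a' a'' hp ha' ha'' => ⟨?_, ?_⟩
    · refine ih (insert s P) Z a' (fun i => ?_) (fun t ht => ?_) fun t ht => ?_
      · have := hU i
        simp only [Finset.mem_insert, Set.mem_insert_iff] at this ⊢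
        tauto
      · rw [ha', hZ t ht, 𝒜.fmul_zero]
      · rcases ht with rfl | ht
        · exact hT.isPositiveOnRow (a t) hp ha'
        · refine (hP t ht).of_left_mul fun x => ⟨x * p, fun i => ?_⟩
          simp only [ha', PreFellBundle.unitFiber_mul_def, ← 𝒜.j_mul_j, mul_assoc]
    · refine ih P (insert s Z) _ (fun i => ?_) (fun t ht => ?_) fun t ht => ?_
      · have := hU i
        simp only [Finset.mem_insert, Set.mem_insert_iff] at this ⊢
        tauto
      · rcases eq_or_ne t s with rfl | hts
        · simp
        · rw [Function.update_of_ne hts, ha'', hZ t (ht.resolve_left hts), 𝒜.fmul_zero, sub_zero]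
      · refine IsPositiveOnRow.update_zero ((hP t ht).of_left_mul fun x => ⟨x - x * v, fun i => ?_⟩) s
        simp only [ha'', PreFellBundle.unitFiber_mul_def, map_sub, ← 𝒜.j_mul_j, mul_assoc, mul_sub,
          sub_mul]

/-- For a positive definite bundle map, the matrices of all `T(a_i⋆ a_j)` are positive. -/
theorem IsPositiveDefinite.hasPositiveMatrix (hT : T.IsPositiveDefinite) (g : ι → G)
    (a : ∀ i, 𝒜.fiber (g i)) : T.HasPositiveMatrix g a := by
  classical
  exact hT.hasPositiveMatrix_aux Finset.univ ∅ ∅ a (by simp) (by simp) (by simp)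

end BundleMap

/-! ### From homogeneous elements to `C*(𝒜)`, and the theorem. -/

lemma PreFellBundle.exists_eq_sum_j {G : Type*} [Group G] (𝒜 : PreFellBundle G)
    (f : 𝒜.Sections) : ∃ F : Finset G, f = ∑ g ∈ F, 𝒜.j g (f g) := by
  classical
  exact ⟨DFinsupp.support f, (DFinsupp.sum_single (f := f)).symm⟩

namespace BundleMap

variable {G H : Type*} [Group G] [Group H] {𝒜 : FellBundle G} {φ : G →* H} {ℬ : FellBundle H}
  {T : BundleMap 𝒜 φ ℬ}

/-- Each `w_i` is expanded into its homogeneous components, all of which receive the same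
coefficient `y_i`. -/
theorem IsPositiveDefinite.isCompletelyPositiveForm (hT : T.IsPositiveDefinite) :
    IsCompletelyPositiveForm T.form := by
  intro n w y
  choose F hF using fun i => 𝒜.exists_eq_sum_j (w i)
  have h := hT.hasPositiveMatrix (ι := Σ i, F i) (fun k => k.2) (fun k => w k.1 k.2)
    (fun k => y k.1)
  refine h.trans_eq ?_
  rw [Fintype.sum_sigma]
  refine Finset.sum_congr rfl fun i _ => ?_
  simp only [Fintype.sum_sigma]
  rw [Finset.sum_comm]
  refine Finset.sum_congr rfl fun j _ => ?_
  conv_rhs => rw [hF i, hF j]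
  simp only [← Finset.sum_coe_sort (F i), ← Finset.sum_coe_sort (F j), star_sum, Finset.sum_mul,
    Finset.mul_sum, map_sum]
  rw [Finset.sum_comm]

lemma norm_form (f : 𝒜.Sections) : ‖T.form f‖ = ℬ.universalNorm (T.sectionsMap f) :=
  ℬ.universalNorm.norm_toCompletion _

theorem IsPositiveDefinite.norm_form_le (hT : T.IsPositiveDefinite) (f : 𝒜.Sections) :
    ‖T.form f‖ ≤ ‖T.map 1‖ * 𝒜.universalNorm f :=
  𝒜.norm_completelyPositiveForm_le hT.isCompletelyPositiveForm T.continuous_form_j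
    (norm_nonneg _) (fun a => by
      rw [form_j, ℬ.norm_jHat]
      exact (T.map 1).le_opNorm a) f

theorem IsPositiveDefinite.isFull (hT : T.IsPositiveDefinite) : T.IsFull :=
  ⟨‖T.map 1‖, fun f => by
    rw [← norm_form]
    exact hT.norm_form_le f⟩

theorem IsFull.fullExtension_jHat (hT : T.IsFull) (g : G) (a : 𝒜.fiber g) :
    T.fullExtension (𝒜.jHat g a) = ℬ.jHat (φ g) (T.map g a) :=
  (T.fullExtension_κ hT (𝒜.j g a)).trans (T.form_j g a)

theorem IsPositiveDefinite.norm_fullExtension (hT : T.IsPositiveDefinite) :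
    ‖T.fullExtension‖ = ‖T.map 1‖ := by
  refine le_antisymm ?_ ?_
  · refine LinearMap.opNorm_extendOfNorm_le 𝒜.universalNorm.denseRange_toCompletion
      (norm_nonneg _) fun f => ?_
    refine (hT.norm_form_le f).trans_eq ?_
    rw [← CStarSeminorm.norm_toCompletion]
  · refine (T.map 1).opNorm_le_bound (norm_nonneg _) fun a => ?_
    rw [← ℬ.norm_jHat, ← hT.isFull.fullExtension_jHat, ← 𝒜.norm_jHat 1 a]
    exact T.fullExtension.le_opNorm _

lemma IsFull.fullExtension_star_mul (hT : T.IsFull) (f f' : 𝒜.Sections) :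
    T.fullExtension (star (𝒜.κ f) * 𝒜.κ f') = T.form (star f * f') := by
  have h : star (𝒜.κ f) * 𝒜.κ f' = 𝒜.κ (star f * f') := by
    refine Eq.trans ?_ (𝒜.universalNorm.toCompletion_mul _ _).symm
    rw [𝒜.universalNorm.toCompletion_star]
    rfl
  rw [h]
  exact T.fullExtension_κ hT _

lemma IsPositiveDefinite.sum_fullExtension_nonneg (hT : T.IsPositiveDefinite) {n : ℕ}
    (x : Fin n → 𝒜.FullCStarAlgebra) (y : Fin n → ℬ.FullCStarAlgebra) :
    0 ≤ ∑ i, ∑ j, y i * T.fullExtension (star (x i) * x j) * star (y j) := by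
  have hd : DenseRange fun (f : Fin n → 𝒜.Sections) i => 𝒜.κ (f i) :=
    DenseRange.piMap fun _ => 𝒜.universalNorm.denseRange_toCompletion
  refine hd.induction_on x (isClosed_le continuous_const ?_) fun f => ?_
  · fun_prop
  · simp only [hT.isFull.fullExtension_star_mul]
    exact hT.isCompletelyPositiveForm n f y

theorem IsPositiveDefinite.isCompletelyPositive (hT : T.IsPositiveDefinite) :
    IsCompletelyPositive T.fullExtension.toLinearMap := by
  refine ⟨⟨T.fullExtension.toLinearMap, fun k M hM => ?_⟩, rfl⟩
  obtain ⟨N, rfl⟩ := exists_eq_star_mul_self_of_nonneg hM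
  rw [CStarMatrix.nonneg_iff_forall_sum_nonneg]
  intro y
  -- `N⋆ N` is the sum over the rows `l` of `N` of the matrices `(N_{li}⋆ N_{lj})`.
  have h : 0 ≤ ∑ l, ∑ i, ∑ j, y i * T.fullExtension (star (N l i) * N l j) * star (y j) :=
    Finset.sum_nonneg fun l _ => hT.sum_fullExtension_nonneg (N l) y
  refine h.trans_eq ?_
  rw [Finset.sum_comm]
  refine Finset.sum_congr rfl fun i _ => ?_
  rw [Finset.sum_comm]
  refine Finset.sum_congr rfl fun j _ => ?_
  rw [CStarMatrix.map_apply, CStarMatrix.mul_apply, map_sum, Finset.mul_sum, Finset.sum_mul]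
  rfl

/-- The matrix `(a_i⋆ a_j)` over `C*(𝒜)` is positive, and its image under `Φ_T` is tested on the
vector of the `b_i`. -/
theorem IsFull.isPositiveDefinite (hT : T.IsFull)
    (hcp : IsCompletelyPositive T.fullExtension.toLinearMap) : T.IsPositiveDefinite := by
  rw [isPositiveDefinite_iff]
  intro n g a b
  obtain ⟨Θ, hΘ⟩ := hcp
  let M : CStarMatrix (Fin n) (Fin n) 𝒜.FullCStarAlgebra :=
    CStarMatrix.ofMatrix fun i j => star (𝒜.jHat _ (a i)) * 𝒜.jHat _ (a j)
  have hM : 0 ≤ M := by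
    rw [CStarMatrix.nonneg_iff_forall_sum_nonneg]
    intro y
    refine (mul_star_self_nonneg (∑ i, y i * star (𝒜.jHat _ (a i)))).trans_eq ?_
    rw [star_sum, Finset.sum_mul]
    refine Finset.sum_congr rfl fun i _ => ?_
    rw [Finset.mul_sum]
    refine Finset.sum_congr rfl fun j _ => ?_
    rw [star_mul, star_star]
    change _ = y i * (star (𝒜.jHat _ (a i)) * 𝒜.jHat _ (a j)) * star (y j)
    simp only [mul_assoc]
  have h := CStarMatrix.nonneg_iff_forall_sum_nonneg.1 (Θ.map_cstarMatrix_nonneg' n M hM)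
    fun i => ℬ.jHat _ (b i)
  refine h.trans_eq (Finset.sum_congr rfl fun i _ => Finset.sum_congr rfl fun j _ => ?_)
  rw [hΘ]
  exact congrArg (fun z => ℬ.jHat _ (b i) * z * star (ℬ.jHat _ (b j)))
    (hT.fullExtension_star_mul (𝒜.j _ (a i)) (𝒜.j _ (a j)))

end BundleMap

/-- `fullExtension` is defined for every `T`; the clause on `jHat` certifies that it is the intended
extension. -/
theorem theorem3p11 {G H : Type*} [Group G] [Group H] (𝒜 : FellBundle G) (ℬ : FellBundle H)
    (φ : G →* H) (T : BundleMap 𝒜 φ ℬ) :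
    (T.IsPositiveDefinite ↔ T.IsFull ∧
      (∀ (g : G) (a : 𝒜.fiber g),
        T.fullExtension (𝒜.jHat g a) = ℬ.jHat (φ g) (T.map g a)) ∧
      IsCompletelyPositive T.fullExtension.toLinearMap) ∧
    (T.IsPositiveDefinite → ‖T.fullExtension‖ = ‖T.map 1‖) :=
  ⟨⟨fun hT => ⟨hT.isFull, hT.isFull.fullExtension_jHat, hT.isCompletelyPositive⟩,
    fun ⟨hT, _, hcp⟩ => hT.isPositiveDefinite hcp⟩, fun hT => hT.norm_fullExtension⟩
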